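/- Let $k$ be an algebraically closed field of characteristic zero (for example $k=\mathbb{C}$). A projective variety over $k$ is an integral scheme over $k$ that is isomorphic over $k$ to a closed subscheme of some $\mathbb{P}^n_k$. For a projective variety $X$, a birational model of $X$ is a birational $k$-morphism $\pi_Y:Y\to X$ with $Y$ a projective variety over $k$, and a model $\pi_Z$ dominates $\pi_Y$ if there is a birational $k$-morphism $\nu:Z\to Y$ with $\pi_Z=\pi_Y\circ\nu$. The Zariski–Riemann space of $X$ is the projective limit $\underline{X}=\varprojlim(\pi_Y:Y\to X)$ of all birational models of $X$, taken in the category of locally ringed spaces and regarded as a locally ringed space over $k$ through its projection $\underline{X}\to X\to\operatorname{Spec}k$. Proposition. Let $X$ and $Y$ be projective varieties over $k$. Then the projective limits $\underline{X}$ and $\underline{Y}$ exist in the category of locally ringed spaces, and $\underline{X}$ and $\underline{Y}$ are isomorphic as locally ringed spaces over $k$ if and only if $X$ and $Y$ are birational over $k$. -/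

import Mathlib

open CategoryTheory CategoryTheory.Limits AlgebraicGeometry

universe u

noncomputable section

namespace ZariskiRiemann

attribute [local instance] MvPolynomial.gradedAlgebra

/-- Projective `n`-space over `k`: the scheme `Proj k[x₀, …, xₙ]`. -/
def projSpace (k : Type u) [Field k] (n : ℕ) : Scheme.{u} :=
  Proj (MvPolynomial.homogeneousSubmodule (Fin (n + 1)) k)

/-- The structure morphism `ℙⁿ ⟶ Spec k`, given by the inclusion of the constants `k` into the
degree zero part of `k[x₀, …, xₙ]`. -/
def projSpaceStr (k : Type u) [Field k] (n : ℕ) : projSpace k n ⟶ Spec (.of k) :=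
  Proj.toSpecZero (MvPolynomial.homogeneousSubmodule (Fin (n + 1)) k) ≫
    Spec.map (CommRingCat.ofHom
      (algebraMap k (MvPolynomial.homogeneousSubmodule (Fin (n + 1)) k 0)))

/-- A projective variety over `k`: an integral `k`-scheme which is isomorphic over `k` to a closed
subscheme of some projective space (it is then separated and of finite type). -/
structure IsProjectiveVariety {k : Type u} [Field k] (X : Over (Spec (.of k))) : Prop where
  isIntegral : IsIntegral X.left
  exists_closedImmersion : ∃ (n : ℕ) (i : X.left ⟶ projSpace k n),
    IsClosedImmersion i ∧ i ≫ projSpaceStr k n = X.hom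

/-- A morphism `f : Y ⟶ X` is birational if it restricts to an isomorphism from a dense open
subscheme of `Y` onto a dense open subscheme of `X`. -/
def IsBirational {X Y : Scheme.{u}} (f : Y ⟶ X) : Prop :=
  ∃ p : Y.PartialIso X, p.iso.hom ≫ p.target.ι = p.source.ι ≫ f

lemma IsBirational.id (X : Scheme.{u}) : IsBirational (𝟙 X) :=
  ⟨.refl X, by simp [Scheme.PartialIso.refl]⟩

lemma IsBirational.comp {X Y Z : Scheme.{u}} {f : Z ⟶ Y} {g : Y ⟶ X}
    (hf : IsBirational f) (hg : IsBirational g) : IsBirational (f ≫ g) := by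
  obtain ⟨p, hp⟩ := hf
  obtain ⟨q, hq⟩ := hg
  have hp' : p.IsOver (f ≫ g) g := by
    have := congrArg (· ≫ g) hp
    simpa [Scheme.PartialIso.IsOver] using this
  have hq' : q.IsOver g (𝟙 X) := by
    simpa [Scheme.PartialIso.IsOver] using hq
  exact ⟨p.trans q, by simpa [Scheme.PartialIso.IsOver] using hp'.trans hq'⟩

variable {k : Type u} [Field k]

/-- A birational model of `X`: a projective variety `Y` over `k` with a birational
`k`-morphism `π : Y ⟶ X`. -/
structure BirationalModel (X : Over (Spec (.of k))) where
  /-- The variety `Y`. -/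
  Y : Over (Spec (.of k))
  isProjectiveVariety : IsProjectiveVariety Y
  /-- The morphism to `X`. -/
  π : Y ⟶ X
  isBirational : IsBirational π.left

namespace BirationalModel

variable {X : Over (Spec (.of k))}

/-- A morphism of models from `Z` to `Y`, exhibiting that `Z` dominates `Y`: a birational
`k`-morphism `ν : Z ⟶ Y` with `π_Z = π_Y ∘ ν`. -/
@[ext]
structure Hom (Z Y : BirationalModel X) where
  /-- The underlying morphism. -/
  ν : Z.Y ⟶ Y.Y
  fac : ν ≫ Y.π = Z.π
  isBirational : IsBirational ν.left

instance : Category (BirationalModel X) where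
  Hom := Hom
  id Y := ⟨𝟙 Y.Y, by simp, IsBirational.id _⟩
  comp f g := ⟨f.ν ≫ g.ν, by rw [Category.assoc, g.fac, f.fac],
    f.isBirational.comp g.isBirational⟩
  id_comp f := Hom.ext (Category.id_comp f.ν)
  comp_id f := Hom.ext (Category.comp_id f.ν)
  assoc f g h := Hom.ext (Category.assoc f.ν g.ν h.ν)

/-- The trivial model `𝟙 : X ⟶ X`. -/
def trivial (X : Over (Spec (.of k))) (hX : IsProjectiveVariety X) : BirationalModel X where
  Y := X
  isProjectiveVariety := hX
  π := 𝟙 X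
  isBirational := IsBirational.id _

/-- The projective system of all birational models of `X`, as locally ringed spaces. -/
def system (X : Over (Spec (.of k))) : BirationalModel X ⥤ LocallyRingedSpace.{u} where
  obj M := M.Y.left.toLocallyRingedSpace
  map f := (Hom.ν f).left.toLRSHom
  map_id _ := rfl
  map_comp _ _ := rfl

end BirationalModel

/-- The Zariski–Riemann space of a projective variety `X` over `k`: the projective limit, in the
category of locally ringed spaces, of all birational models of `X`. It is regarded as a locally
ringed space over `k` through its projection to `X`. -/
def space (X : Over (Spec (.of k))) (hX : IsProjectiveVariety X)
    [HasLimit (BirationalModel.system X)] :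
    Over (Spec (.of k)).toLocallyRingedSpace :=
  Over.mk (Y := limit (BirationalModel.system X))
    (limit.π (BirationalModel.system X) (BirationalModel.trivial X hX) ≫ X.hom.toLRSHom)

end ZariskiRiemann

end

/-! Birational equivalence is read off from field-valued points. A dominant preimmersion `Spec K ⟶
X` identifies `K` with the function field of an integral scheme (`isIso_stalkClosedPointTo`). Two
integral separated schemes, locally of finite type over `S`, are birational over `S` once they carry
such points with the same `K` and the same composite to `S` (`birationalOver_of_isGenericPoint`).

Existence of the limit: a generic point of `X` lifts compatibly to all models, so all local rings of
all models lie in one field `K`. The models form an essentially small cofiltered category, and for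
such a system the limit can be written down: compatible families of points, with the sheaf of
locally constant `K`-valued functions whose value at a family lies in the union of the local rings
at its coordinates (`isLimitLimitCone`).

Birational implies isomorphic: a common generic point of `X` and `Y`, placed in projective space by
the Segre embedding, has as closure a projective variety `Z` mapping birationally to both
(`exists_join_isBirational`). The models that factor through `Z` are cofinal among the models of `X`
and likewise for `Y` (`initial_pushforward`), so all three limits agree.

Isomorphic implies birational: the isomorphism carries the generic point of the first space to a
`K`-point of the second. This point specializes to a generic point there, so it is dominant on every
model. A stalk of the limit is the union of the stalks of the models, and near a dominant point each
model looks like `Y`. Hence `K` is already exhausted by the stalk of `Y`, and the `K`-point of `Y`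
is generic. -/

noncomputable section

/-! ### Germs of pulled-back sections -/

namespace AlgebraicGeometry.LocallyRingedSpace

open TopologicalSpace Opposite TopCat

/-- The pullback of a section along a morphism of presheafed spaces, followed by the germ at a
point. -/
def pullbackGerm {T Y : PresheafedSpace CommRingCat.{u}} (g : T ⟶ Y) (t : T) (U : Opens Y)
    (h : g.base t ∈ U) : Y.presheaf.obj (op U) →+* T.presheaf.stalk t :=
  (g.c.app (op U) ≫ T.presheaf.germ ((Opens.map g.base).obj U) t h).hom

lemma pullbackGerm_eq {T Y : PresheafedSpace CommRingCat.{u}} (g : T ⟶ Y) (t : T) (U : Opens Y)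
    (h : g.base t ∈ U) (s) :
    pullbackGerm g t U h s = g.stalkMap t (Y.presheaf.germ U _ h s) :=
  (ConcreteCategory.congr_hom (PresheafedSpace.stalkMap_germ g U t h) s).symm

lemma pullbackGerm_map {T Y : PresheafedSpace CommRingCat.{u}} (g : T ⟶ Y) (t : T)
    {U V : Opens Y} (i : V ⟶ U) (h : g.base t ∈ V) (s) :
    pullbackGerm g t V h (Y.presheaf.map i.op s) = pullbackGerm g t U (i.le h) s := by
  rw [pullbackGerm_eq, pullbackGerm_eq, TopCat.Presheaf.germ_res_apply]

lemma pullbackGerm_comp {T Y Z : PresheafedSpace CommRingCat.{u}} (g : T ⟶ Y) (f : Y ⟶ Z) (t : T)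
    (U : Opens Z) (h : (g ≫ f).base t ∈ U) (s) :
    pullbackGerm (g ≫ f) t U h s =
      pullbackGerm g t ((Opens.map f.base).obj U) h (f.c.app (op U) s) :=
  rfl

lemma pullbackGerm_comp_eq_stalkMap {T Y Z : PresheafedSpace CommRingCat.{u}} (g : T ⟶ Y)
    (f : Y ⟶ Z) (t : T) (U : Opens Z) (h : (g ≫ f).base t ∈ U) (s) :
    pullbackGerm (g ≫ f) t U h s = g.stalkMap t (pullbackGerm f (g.base t) U h s) :=
  pullbackGerm_eq g t ((Opens.map f.base).obj U) h _

/-- `s` has pullback germ `b` at `t` along `g`. -/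
def HasGerm {T Y : PresheafedSpace CommRingCat.{u}} (g : T ⟶ Y) (t : T) (U : Opens Y)
    (s : Y.presheaf.obj (op U)) (b : T.presheaf.stalk t) : Prop :=
  ∃ h : g.base t ∈ U, pullbackGerm g t U h s = b

lemma hasGerm_unique {T Y : PresheafedSpace CommRingCat.{u}} {g : T ⟶ Y} {t : T} {U : Opens Y}
    {s : Y.presheaf.obj (op U)} {b b' : T.presheaf.stalk t} (h : HasGerm g t U s b)
    (h' : HasGerm g t U s b') : b = b' := by
  obtain ⟨_, rfl⟩ := h
  obtain ⟨_, rfl⟩ := h'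
  rfl

/-- Sections of a sheaf are determined by their germs. Comparing germs through `HasGerm` avoids
transporting along the equality of base maps. -/
lemma hom_ext_of_hasGerm {T Y : LocallyRingedSpace.{u}} (g g' : T ⟶ Y)
    (hb : ∀ t, g.base t = g'.base t)
    (hs : ∀ t U s, g.base t ∈ U → ∃ b, HasGerm g.toHom t U s b ∧ HasGerm g'.toHom t U s b) :
    g = g' := by
  obtain ⟨⟨b, c⟩, p⟩ := g
  obtain ⟨⟨b', c'⟩, p'⟩ := g'
  obtain rfl : b = b' := by ext t; exact hb t
  suffices c = c' by subst this; rfl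
  ext U s
  refine TopCat.Presheaf.section_ext T.sheaf _ _ _ fun t ht ↦ ?_
  obtain ⟨_, ⟨h, rfl⟩, ⟨h', e⟩⟩ := hs t U s ht
  exact e.symm

end AlgebraicGeometry.LocallyRingedSpace

/-! ### Cofiltered systems with a generic point: the limit space and its sheaf -/

namespace AlgebraicGeometry.LocallyRingedSpace

open TopologicalSpace Opposite TopCat

namespace GenericLimit

variable {J : Type u} [SmallCategory J] (F : J ⥤ LocallyRingedSpace.{u})

/-- Compatible families of points of a diagram of locally ringed spaces. -/
def Point : Type u :=
  {z : ∀ j, F.obj j // ∀ i j (f : i ⟶ j), (F.map f).base (z i) = z j}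

instance : TopologicalSpace (Point F) :=
  inferInstanceAs (TopologicalSpace {_z : ∀ j, F.obj j // _})

/-- The topological space of compatible families of points of a diagram. -/
def pointTop : TopCat.{u} := TopCat.of (Point F)

/-- The coordinate of a compatible family. -/
def coord (j : J) : pointTop F ⟶ (F.obj j).toTopCat :=
  TopCat.ofHom ⟨fun z : Point F ↦ z.1 j, (continuous_apply j).comp continuous_subtype_val⟩

variable {F} in
lemma specializes_of_forall_coord {w z : pointTop F} (h : ∀ j, coord F j w ⤳ coord F j z) :
    w ⤳ z :=
  (Topology.IsInducing.subtypeVal (t := {z : ∀ j, F.obj j |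
    ∀ i j (f : i ⟶ j), (F.map f).base (z i) = z j})).specializes_iff.mp (specializes_pi.mpr h)

/-- The point of the limit of a diagram determined by a point of a cone over it. -/
def pointOfCone {F : J ⥤ LocallyRingedSpace.{u}} (c : Cone F) (t : c.pt) : Point F :=
  ⟨fun j ↦ (c.π.app j).base t, fun i j f ↦ by
    change _ = (c.π.app j).base t
    rw [← c.w f]; rfl⟩

variable {F} (E : Cone F) (p : E.pt)

/-- A cone over a diagram, with a distinguished point, is *generic* if the point maps into every
nonempty open set of the diagram and sections are determined by their germs at the point. -/
structure IsGeneric : Prop where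
  mem : ∀ j (U : Opens (F.obj j).toTopCat) (y), y ∈ U → (E.π.app j).base p ∈ U
  inj : ∀ j U h, Function.Injective (pullbackGerm (E.π.app j).toHom p U h)

variable {E p} [IsCofiltered J]

/-- Cofilteredness lets two sections living on different objects be pulled back to one object, where
they can be added, multiplied and compared. The last clause keeps track of the map along which `s`
was pulled back, which is needed to descend units in `isLocalHom_proj`. -/
lemma exists_common {j j' : J} {U : Opens (F.obj j).toTopCat} {U' : Opens (F.obj j').toTopCat}
    (s : (F.obj j).presheaf.obj (op U)) (s' : (F.obj j').presheaf.obj (op U')) :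
    ∃ (l : J) (W : Opens (F.obj l).toTopCat) (t t' : (F.obj l).presheaf.obj (op W))
      (f : l ⟶ j),
      (∀ z : Point F, z.1 j ∈ U → z.1 j' ∈ U' → z.1 l ∈ W) ∧
      (∀ (c : Cone F) (x : c.pt) b b', HasGerm (c.π.app j).toHom x U s b →
        HasGerm (c.π.app j').toHom x U' s' b' →
        HasGerm (c.π.app l).toHom x W t b ∧ HasGerm (c.π.app l).toHom x W t' b') ∧
      ∀ y ∈ W, ∃ b, HasGerm (F.map f).toHom y U s b ∧
        HasGerm (𝟙 (F.obj l).toPresheafedSpace) y W t b := by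
  obtain ⟨l, f, f', -⟩ := IsCofilteredOrEmpty.cone_objs j j'
  let W : Opens (F.obj l).toTopCat :=
    (Opens.map (F.map f).base).obj U ⊓ (Opens.map (F.map f').base).obj U'
  have hW : W ≤ (Opens.map (F.map f).base).obj U := inf_le_left
  have hW' : W ≤ (Opens.map (F.map f').base).obj U' := inf_le_right
  refine ⟨l, W, (F.obj l).presheaf.map (homOfLE hW).op ((F.map f).c.app (op U) s),
    (F.obj l).presheaf.map (homOfLE hW').op ((F.map f').c.app (op U') s'), f, ?_, ?_, ?_⟩
  · intro z h h'
    refine ⟨?_, ?_⟩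
    · change (F.map f).base (z.1 l) ∈ U
      rwa [z.2]
    · change (F.map f').base (z.1 l) ∈ U'
      rwa [z.2]
  · intro c x b b' h h'
    rw [← c.w f] at h
    rw [← c.w f'] at h'
    obtain ⟨h, rfl⟩ := h
    obtain ⟨h', rfl⟩ := h'
    refine ⟨⟨⟨h, h'⟩, ?_⟩, ⟨⟨h, h'⟩, ?_⟩⟩
    · exact pullbackGerm_map _ _ _ _ _
    · exact pullbackGerm_map _ _ _ _ _
  · intro y hy
    refine ⟨_, ⟨hW hy, rfl⟩, ⟨hy, ?_⟩⟩
    refine (pullbackGerm_map _ _ _ _ _).trans ?_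
    exact (pullbackGerm_comp (𝟙 _) (F.map f).toHom y U (hW hy) s).symm

variable (E p) in
/-- The germ `a` at the distinguished point and the germ `b` at `x` come from one section of
an object of the diagram. -/
def GermRel (c : Cone F) (x : c.pt) (a : E.pt.presheaf.stalk p) (b : c.pt.presheaf.stalk x) :
    Prop :=
  ∃ j U s, HasGerm (E.π.app j).toHom p U s a ∧ HasGerm (c.π.app j).toHom x U s b

section
variable {c : Cone F} {x : c.pt} {a a' : E.pt.presheaf.stalk p} {b b' : c.pt.presheaf.stalk x}

lemma GermRel.exists_common (h : GermRel E p c x a b) (h' : GermRel E p c x a' b') :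
    ∃ j U s s', HasGerm (E.π.app j).toHom p U s a ∧ HasGerm (c.π.app j).toHom x U s b ∧
      HasGerm (E.π.app j).toHom p U s' a' ∧ HasGerm (c.π.app j).toHom x U s' b' := by
  obtain ⟨j, U, s, ha, hb⟩ := h
  obtain ⟨j', U', s', ha', hb'⟩ := h'
  obtain ⟨l, W, t, t', f, -, H, -⟩ := GenericLimit.exists_common s s'
  exact ⟨l, W, t, t', (H _ _ _ _ ha ha').1, (H _ _ _ _ hb hb').1, (H _ _ _ _ ha ha').2,
    (H _ _ _ _ hb hb').2⟩

/-- On a common object the two sections have the same germ at the distinguished point, hence are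
equal by genericity. So `GermRel` is the graph of a partial function, and `GermRel.add` and its
companions make it compatible with the ring operations. -/
lemma GermRel.unique (hE : IsGeneric E p) (h : GermRel E p c x a b) (h' : GermRel E p c x a b') :
    b = b' := by
  obtain ⟨j, U, s, s', ⟨h1, h2⟩, hb, ⟨h3, h4⟩, hb'⟩ := h.exists_common h'
  obtain rfl : s = s' := hE.inj j U h1 (h2.trans h4.symm)
  exact hasGerm_unique hb hb'

lemma GermRel.add (h : GermRel E p c x a b) (h' : GermRel E p c x a' b') :
    GermRel E p c x (a + a') (b + b') := by
  obtain ⟨j, U, s, s', ⟨h1, rfl⟩, ⟨h2, rfl⟩, ⟨_, rfl⟩, ⟨_, rfl⟩⟩ := h.exists_common h'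
  exact ⟨j, U, s + s', ⟨h1, map_add _ _ _⟩, ⟨h2, map_add _ _ _⟩⟩

lemma GermRel.mul (h : GermRel E p c x a b) (h' : GermRel E p c x a' b') :
    GermRel E p c x (a * a') (b * b') := by
  obtain ⟨j, U, s, s', ⟨h1, rfl⟩, ⟨h2, rfl⟩, ⟨_, rfl⟩, ⟨_, rfl⟩⟩ := h.exists_common h'
  exact ⟨j, U, s * s', ⟨h1, map_mul _ _ _⟩, ⟨h2, map_mul _ _ _⟩⟩

lemma GermRel.zero : GermRel E p c x 0 0 :=
  ⟨(IsCofiltered.nonempty (C := J)).some, ⊤, 0, ⟨trivial, map_zero _⟩, ⟨trivial, map_zero _⟩⟩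

lemma GermRel.one : GermRel E p c x 1 1 :=
  ⟨(IsCofiltered.nonempty (C := J)).some, ⊤, 1, ⟨trivial, map_one _⟩, ⟨trivial, map_one _⟩⟩

end

variable (E p) in
/-- The elements of the stalk at the distinguished point which are germs of sections defined near
the point `z` of the limit. -/
def localSubring (z : Point F) : Subring (E.pt.presheaf.stalk p) where
  carrier := {a | ∃ j U s, z.1 j ∈ U ∧ HasGerm (E.π.app j).toHom p U s a}
  mul_mem' := by
    rintro a b ⟨j, U, s, hz, hs⟩ ⟨j', U', s', hz', hs'⟩
    obtain ⟨l, W, t, t', f, H1, H, -⟩ := GenericLimit.exists_common s s'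
    obtain ⟨⟨h, rfl⟩, ⟨_, rfl⟩⟩ := H _ _ _ _ hs hs'
    exact ⟨l, W, t * t', H1 z hz hz', h, map_mul _ _ _⟩
  add_mem' := by
    rintro a b ⟨j, U, s, hz, hs⟩ ⟨j', U', s', hz', hs'⟩
    obtain ⟨l, W, t, t', f, H1, H, -⟩ := GenericLimit.exists_common s s'
    obtain ⟨⟨h, rfl⟩, ⟨_, rfl⟩⟩ := H _ _ _ _ hs hs'
    exact ⟨l, W, t + t', H1 z hz hz', h, map_add _ _ _⟩
  one_mem' := ⟨(IsCofiltered.nonempty (C := J)).some, ⊤, 1, trivial, ⟨trivial, map_one _⟩⟩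
  zero_mem' := ⟨(IsCofiltered.nonempty (C := J)).some, ⊤, 0, trivial, ⟨trivial, map_zero _⟩⟩
  neg_mem' := by
    rintro a ⟨j, U, s, hz, ⟨h, rfl⟩⟩
    exact ⟨j, U, -s, hz, h, map_neg _ _⟩

variable (E p) in
/-- Constant functions whose value lies in the local ring of every point. -/
def constPredicate : PrelocalPredicate (X := pointTop F)
    (fun _ ↦ E.pt.presheaf.stalk p) where
  pred {U} f := ∃ a, ∀ x : U, f x = a ∧ a ∈ localSubring E p x.1
  res i _ := fun ⟨a, h⟩ ↦ ⟨a, fun x ↦ h (i x)⟩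

variable (E p) in
/-- The sections of the limit over an open set: locally constant functions whose values lie in
the local rings. -/
def sections (U : Opens (pointTop F)) : Subring (U → E.pt.presheaf.stalk p) where
  carrier := {f | (constPredicate E p).sheafify.pred f}
  mul_mem' ha hb := PrelocalPredicate.sheafify_inductionOn₂' (constPredicate E p) (constPredicate E p)
    (constPredicate E p) (fun x y ↦ x * y)
    (fun ⟨a, ha⟩ ⟨b, hb⟩ ↦ ⟨a * b, fun x ↦
      ⟨congrArg₂ (· * ·) (ha ⟨x, x.2.1⟩).1 (hb ⟨x, x.2.2⟩).1,
      mul_mem (ha ⟨x, x.2.1⟩).2 (hb ⟨x, x.2.2⟩).2⟩⟩) ha hb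
  add_mem' ha hb := PrelocalPredicate.sheafify_inductionOn₂' (constPredicate E p) (constPredicate E p)
    (constPredicate E p) (fun x y ↦ x + y)
    (fun ⟨a, ha⟩ ⟨b, hb⟩ ↦ ⟨a + b, fun x ↦
      ⟨congrArg₂ (· + ·) (ha ⟨x, x.2.1⟩).1 (hb ⟨x, x.2.2⟩).1,
      add_mem (ha ⟨x, x.2.1⟩).2 (hb ⟨x, x.2.2⟩).2⟩⟩) ha hb
  one_mem' := PrelocalPredicate.sheafifyOf ⟨1, fun _ ↦ ⟨rfl, one_mem _⟩⟩
  zero_mem' := PrelocalPredicate.sheafifyOf ⟨0, fun _ ↦ ⟨rfl, zero_mem _⟩⟩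
  neg_mem' ha := PrelocalPredicate.sheafify_inductionOn' (constPredicate E p) (fun x ↦ -x)
    (fun ⟨a, ha⟩ ↦ ⟨-a, fun x ↦ ⟨congrArg Neg.neg (ha x).1, neg_mem (ha x).2⟩⟩) ha

variable (E p) in
/-- The structure presheaf of the limit. -/
def structurePresheaf : TopCat.Presheaf CommRingCat.{u} (pointTop F) where
  obj U := .of (sections E p U.unop)
  map i := CommRingCat.ofHom
    { toFun := fun f ↦ ⟨fun x ↦ f.1 (i.unop x),
        (constPredicate E p).sheafify.res i.unop f.1 f.2⟩
      map_add' _ _ := rfl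
      map_mul' _ _ := rfl
      map_one' := rfl
      map_zero' := rfl }

lemma structurePresheaf_isSheaf : (structurePresheaf E p).IsSheaf := by
  rw [TopCat.Presheaf.isSheaf_iff_isSheaf_comp (forget CommRingCat)]
  exact subpresheafToTypes.isSheaf (constPredicate E p).sheafify

variable (E p) in
/-- The limit as a presheafed space. -/
def space : PresheafedSpace CommRingCat.{u} where
  carrier := pointTop F
  presheaf := structurePresheaf E p

variable (E p) in
/-- Evaluation of a germ at its point. -/
def evalStalk (z : pointTop F) : (space E p).presheaf.stalk z ⟶ E.pt.presheaf.stalk p :=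
  colimit.desc ((OpenNhds.inclusion z).op ⋙ structurePresheaf E p)
    { pt := E.pt.presheaf.stalk p
      ι :=
        { app U := CommRingCat.ofHom ((Pi.evalRingHom _ ⟨z, U.unop.2⟩).comp
            (sections E p U.unop.1).subtype)
          naturality _ _ _ := rfl } }

lemma evalStalk_germ (z : pointTop F) (U : Opens (pointTop F)) (h : z ∈ U) (s : sections E p U) :
    evalStalk E p z ((space E p).presheaf.germ U z h s) = s.1 ⟨z, h⟩ :=
  ConcreteCategory.congr_hom (colimit.ι_desc
    (F := (OpenNhds.inclusion z).op ⋙ structurePresheaf E p) _ (op ⟨U, h⟩)) s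

/-- Near a point every section is constant, so its value there determines its germ. The stalks of
the limit are thereby subrings of the stalk at the distinguished point. -/
lemma evalStalk_injective (z : pointTop F) : Function.Injective (evalStalk E p z) := by
  intro σ τ h
  obtain ⟨U, hU, s, rfl⟩ := TopCat.Presheaf.exists_germ_eq _ σ
  obtain ⟨V, hV, t, rfl⟩ := TopCat.Presheaf.exists_germ_eq _ τ
  erw [evalStalk_germ, evalStalk_germ] at h
  obtain ⟨U', hzU, iU, a, ha⟩ := s.2 ⟨z, hU⟩
  obtain ⟨V', hzV, iV, b, hb⟩ := t.2 ⟨z, hV⟩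
  have hab : a = b := ((ha ⟨z, hzU⟩).1.symm.trans h).trans (hb ⟨z, hzV⟩).1
  refine TopCat.Presheaf.germ_ext _ (U' ⊓ V') ⟨hzU, hzV⟩ (Opens.infLELeft _ _ ≫ iU)
    (Opens.infLERight _ _ ≫ iV) ?_
  refine Subtype.ext (funext fun x ↦ ?_)
  exact (ha ⟨x.1, x.2.1⟩).1.trans (hab.trans (hb ⟨x.1, x.2.2⟩).1.symm)

end GenericLimit

end AlgebraicGeometry.LocallyRingedSpace

/-! ### The limit as a locally ringed space and its universal property -/

namespace AlgebraicGeometry.LocallyRingedSpace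

open TopologicalSpace Opposite TopCat

namespace GenericLimit

variable {J : Type u} [SmallCategory J] {F : J ⥤ LocallyRingedSpace.{u}} {E : Cone F} {p : E.pt}
  [IsCofiltered J] (hE : IsGeneric E p)

/-- The pullback of a section of an object of the diagram to the limit. -/
def pullbackSection (j : J) (U : Opens (F.obj j).toTopCat) :
    (F.obj j).presheaf.obj (op U) →+* sections E p ((Opens.map (coord F j)).obj U) where
  toFun s := ⟨fun x ↦ pullbackGerm (E.π.app j).toHom p U (hE.mem j U _ x.2) s, fun x ↦
    ⟨_, x.2, 𝟙 _, pullbackGerm (E.π.app j).toHom p U (hE.mem j U _ x.2) s, fun y ↦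
      ⟨rfl, j, U, s, y.2, _, rfl⟩⟩⟩
  map_one' := Subtype.ext (funext fun _ ↦ map_one _)
  map_zero' := Subtype.ext (funext fun _ ↦ map_zero _)
  map_add' _ _ := Subtype.ext (funext fun _ ↦ map_add _ _ _)
  map_mul' _ _ := Subtype.ext (funext fun _ ↦ map_mul _ _ _)

/-- The projection from the limit to an object of the diagram, as a morphism of presheafed
spaces. -/
def proj (j : J) : space E p ⟶ (F.obj j).toPresheafedSpace where
  base := coord F j
  c :=
    { app U := CommRingCat.ofHom (pullbackSection hE j U.unop)
      naturality U V i := by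
        ext s
        exact Subtype.ext (funext fun x ↦ pullbackGerm_map _ _ i.unop _ s) }

lemma hasGerm_evalStalk {j : J} {z : pointTop F} {U : Opens (F.obj j).toTopCat}
    {s : (F.obj j).presheaf.obj (op U)} {σ : (space E p).presheaf.stalk z}
    (h : HasGerm (proj hE j) z U s σ) :
    HasGerm (E.π.app j).toHom p U s (evalStalk E p z σ) := by
  obtain ⟨h, rfl⟩ := h
  exact ⟨hE.mem j U _ h, (evalStalk_germ z ((Opens.map (coord F j)).obj U) h
    (pullbackSection hE j U s)).symm⟩

/-- The local constant value lies in `localSubring`, hence comes from a section on a single object.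
This says that the stalk of the limit is the union of the images of the stalks of the system. -/
lemma exists_hasGerm (z : pointTop F) (σ : (space E p).presheaf.stalk z) :
    ∃ j U s, HasGerm (proj hE j) z U s σ := by
  obtain ⟨V, hV, s, rfl⟩ := TopCat.Presheaf.exists_germ_eq _ σ
  obtain ⟨V', hzV, iV, a, ha⟩ := s.2 ⟨z, hV⟩
  obtain ⟨j, U, t, hz, ht⟩ := (ha ⟨z, hzV⟩).2
  refine ⟨j, U, t, hz, evalStalk_injective z ?_⟩
  refine (hasGerm_unique (hasGerm_evalStalk hE ⟨hz, rfl⟩) ht).trans ?_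
  exact (ha ⟨z, hzV⟩).1.symm.trans (evalStalk_germ z V hV s).symm

lemma exists_stalkMap_eq (z : pointTop F) (σ : (space E p).presheaf.stalk z) :
    ∃ j τ, (proj hE j).stalkMap z τ = σ := by
  obtain ⟨j, U, s, h, rfl⟩ := exists_hasGerm hE z σ
  exact ⟨j, _, (pullbackGerm_eq _ _ _ _ _).symm⟩

include hE in
lemma isLocalRing_stalk (z : pointTop F) : IsLocalRing ((space E p).presheaf.stalk z) := by
  have : Nontrivial ((space E p).presheaf.stalk z) := (evalStalk E p z).hom.domain_nontrivial
  refine .of_isUnit_or_isUnit_one_sub_self fun σ ↦ ?_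
  obtain ⟨j, τ, rfl⟩ := exists_stalkMap_eq hE z σ
  refine (IsLocalRing.isUnit_or_isUnit_one_sub_self τ).imp (fun h ↦ h.map _) fun h ↦ ?_
  have := h.map ((proj hE j).stalkMap z).hom
  rwa [map_sub, map_one] at this

/-- The limit as a locally ringed space. -/
def limitSpace : LocallyRingedSpace.{u} where
  toPresheafedSpace := space E p
  IsSheaf := structurePresheaf_isSheaf
  isLocalRing := isLocalRing_stalk hE

/-- An inverse of the image of a germ comes from some other object. On a common object the product
of the two sections is 1, by injectivity at the distinguished point, so the pulled-back germ is
already a unit there. The transition map is local, so the original germ is a unit. -/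
lemma isLocalHom_proj (j : J) (z : pointTop F) : IsLocalHom ((proj hE j).stalkMap z).hom := by
  refine ⟨fun τ hτ ↦ ?_⟩
  obtain ⟨σ, hσ⟩ := hτ.exists_right_inv
  obtain ⟨i, V, s', hs'⟩ := exists_hasGerm hE z σ
  obtain ⟨U, hU, s, rfl⟩ := TopCat.Presheaf.exists_germ_eq _ τ
  obtain ⟨l, W, t, t', f, H1, H2, H3⟩ := exists_common s s'
  obtain ⟨⟨hW, h1⟩, ⟨_, h2⟩⟩ := H2 E p _ _ (hasGerm_evalStalk hE ⟨hU, pullbackGerm_eq _ _ _ _ _⟩)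
    (hasGerm_evalStalk hE hs')
  have ht : t * t' = 1 := by
    refine hE.inj l W hW ?_
    rw [map_mul, h1, h2, map_one, ← map_mul]
    erw [hσ]
    rw [map_one]
  obtain ⟨b, ⟨hb, e⟩, ⟨hb', e'⟩⟩ := H3 (z.1 l) (H1 z hU hs'.1)
  have hbu : IsUnit b := by
    rw [← e']
    exact (IsUnit.of_mul_eq_one _ ht).map _
  rw [← e, pullbackGerm_eq] at hbu
  have := (isUnit_map_iff ((F.map f).stalkMap (z.1 l)).hom _).mp hbu
  have hz := z.2 l j f
  -- The point `(F.map f).base (z.1 l)` equals `z.1 j` only propositionally, so the germ is moved by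
  -- generalizing the point.
  have key : ∀ (y : F.obj j) (hy : y ∈ U), y = z.1 j →
      IsUnit ((F.obj j).presheaf.germ U y hy s) →
      IsUnit ((F.obj j).presheaf.germ U (z.1 j) hU s) := by
    rintro y hy rfl h
    exact h
  exact key _ hb hz this

/-- The projection from the limit to an object of the diagram. -/
def limitProj (j : J) : limitSpace hE ⟶ F.obj j where
  toHom := proj hE j
  prop := isLocalHom_proj hE j

/-- The limit cone. -/
def limitCone : Cone F where
  pt := limitSpace hE
  π :=
    { app := limitProj hE
      naturality i j f := by
        refine (Category.id_comp (limitProj hE j)).trans ?_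
        refine hom_ext_of_hasGerm _ _ (fun z ↦ (z.2 i j f).symm) fun z U s h ↦ ?_
        refine ⟨_, ⟨h, rfl⟩, ?_⟩
        have h' : (limitProj hE i ≫ F.map f).base z ∈ U := by
          change (F.map f).base (z.1 i) ∈ U
          rwa [z.2 i j f]
        refine ⟨h', evalStalk_injective z ?_⟩
        have h1 := hasGerm_evalStalk hE (j := j) (z := z) (U := U) (s := s) ⟨h, rfl⟩
        have h2 := hasGerm_evalStalk hE (j := i) (z := z) (s := (F.map f).c.app (op U) s)
          ⟨h', rfl⟩
        refine hasGerm_unique (g := (E.π.app j).toHom) (U := U) (s := s) ?_ h1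
        rw [← E.w f]
        exact h2 }

section lift

variable (c : Cone F)

/-- The map of spaces from the vertex of a cone to the limit. -/
def liftBase : c.pt.toTopCat ⟶ pointTop F :=
  TopCat.ofHom ⟨pointOfCone c, by
    refine Continuous.subtype_mk (continuous_pi fun j ↦ ?_) _
    exact ((c.π.app j).base.hom).continuous⟩

variable {c} in
include hE in
-- Locally the section is a constant coming from one object of the system, which can be pulled back
-- along the cone. The local pullbacks agree on overlaps by `GermRel.unique` and glue. The
-- uniqueness also makes the resulting map a ring homomorphism natural in `U`.
lemma existsUnique_section (U : Opens (pointTop F)) (s : sections E p U) :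
    ∃! r : c.pt.presheaf.obj (op ((Opens.map (liftBase c)).obj U)),
      ∀ t (ht : t ∈ (Opens.map (liftBase c)).obj U),
        GermRel E p c t (s.1 ⟨liftBase c t, ht⟩) (c.pt.presheaf.germ _ t ht r) := by
  have H : ∀ t : (Opens.map (liftBase c)).obj U, ∃ (N : Opens c.pt.toTopCat) (_ : t.1 ∈ N)
      (i : N ⟶ (Opens.map (liftBase c)).obj U) (r : c.pt.presheaf.obj (op N)),
      ∀ t' (ht' : t' ∈ N), GermRel E p c t' (s.1 ⟨liftBase c t', i.le ht'⟩)
        (c.pt.presheaf.germ _ t' ht' r) := by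
    rintro ⟨t, ht⟩
    obtain ⟨V, hzV, iV, a, ha⟩ := s.2 ⟨liftBase c t, ht⟩
    obtain ⟨j, U', s', hz, hs'⟩ := (ha ⟨_, hzV⟩).2
    let M : Opens c.pt.toTopCat := (Opens.map (c.π.app j).base).obj U'
    let N : Opens c.pt.toTopCat := (Opens.map (liftBase c)).obj V ⊓ M
    have hN : N ≤ M := inf_le_right
    refine ⟨N, ⟨hzV, hz⟩, homOfLE fun x hx ↦ iV.le hx.1,
      c.pt.presheaf.map (homOfLE hN).op ((c.π.app j).c.app (op U') s'), fun t' ht' ↦ ?_⟩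
    have h1 := (ha ⟨liftBase c t', ht'.1⟩).1
    refine ⟨j, U', s', ?_, hN ht', ?_⟩
    · convert hs'
      exact h1
    · exact (TopCat.Presheaf.germ_res_apply c.pt.presheaf (homOfLE hN) t' ht' _).symm
  choose N hN i r hr using H
  obtain ⟨g, hg, -⟩ := c.pt.sheaf.existsUnique_gluing' N ((Opens.map (liftBase c)).obj U) i
    (fun t ht ↦ Opens.mem_iSup.mpr ⟨⟨t, ht⟩, hN _⟩) r (by
      intro a b
      refine TopCat.Presheaf.section_ext c.pt.sheaf _ _ _ fun t ht ↦ ?_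
      erw [TopCat.Presheaf.germ_res_apply, TopCat.Presheaf.germ_res_apply]
      exact (hr a t ht.1).unique hE (hr b t ht.2))
  have hg' : ∀ t (ht : t ∈ (Opens.map (liftBase c)).obj U),
        GermRel E p c t (s.1 ⟨liftBase c t, ht⟩) (c.pt.presheaf.germ _ t ht g) := by
    intro t ht
    have := hr ⟨t, ht⟩ t (hN _)
    rw [← hg ⟨t, ht⟩] at this
    erw [TopCat.Presheaf.germ_res_apply] at this
    exact this
  refine ⟨g, hg', fun g' h' ↦ ?_⟩
  refine TopCat.Presheaf.section_ext c.pt.sheaf _ _ _ fun t ht ↦ ?_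
  exact (h' t ht).unique hE (hg' t ht)

/-- The map of sections from the limit to the vertex of a cone. -/
def liftSection (U : Opens (pointTop F)) :
    sections E p U →+* c.pt.presheaf.obj (op ((Opens.map (liftBase c)).obj U)) where
  toFun s := (existsUnique_section hE U s).choose
  map_one' := ((existsUnique_section hE U 1).choose_spec.2 _ fun t ht ↦ by
    rw [map_one]; exact GermRel.one).symm
  map_zero' := ((existsUnique_section hE U 0).choose_spec.2 _ fun t ht ↦ by
    rw [map_zero]; exact GermRel.zero).symm
  map_add' a b := ((existsUnique_section hE U (a + b)).choose_spec.2 _ fun t ht ↦ by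
    rw [map_add]
    exact ((existsUnique_section hE U a).choose_spec.1 t ht).add
      ((existsUnique_section hE U b).choose_spec.1 t ht)).symm
  map_mul' a b := ((existsUnique_section hE U (a * b)).choose_spec.2 _ fun t ht ↦ by
    rw [map_mul]
    exact ((existsUnique_section hE U a).choose_spec.1 t ht).mul
      ((existsUnique_section hE U b).choose_spec.1 t ht)).symm

lemma germRel_liftSection (U : Opens (pointTop F)) (s : sections E p U) (t : c.pt)
    (ht : liftBase c t ∈ U) : GermRel E p c t (s.1 ⟨liftBase c t, ht⟩)
      (c.pt.presheaf.germ ((Opens.map (liftBase c)).obj U) t ht (liftSection hE c U s)) :=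
  (existsUnique_section hE U s).choose_spec.1 t ht

/-- The morphism of presheafed spaces from the vertex of a cone to the limit. -/
def liftHom : c.pt.toPresheafedSpace ⟶ space E p where
  base := liftBase c
  c :=
    { app U := CommRingCat.ofHom (liftSection hE c U.unop)
      naturality U V i := by
        ext s
        refine TopCat.Presheaf.section_ext c.pt.sheaf _ _ _ fun t ht ↦ ?_
        refine (germRel_liftSection hE c V.unop ((structurePresheaf E p).map i s) t ht).unique hE ?_
        have h := germRel_liftSection hE c U.unop s t (i.unop.le ht)
        refine Eq.mpr (congrArg (GermRel E p c t _) ?_) h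
        exact TopCat.Presheaf.germ_res_apply c.pt.presheaf
          ((Opens.map (liftBase c)).map i.unop) t ht _ }

lemma hasGerm_liftHom_proj {j : J} {t : c.pt} {U : Opens (F.obj j).toTopCat}
    {s : (F.obj j).presheaf.obj (op U)} {b : c.pt.presheaf.stalk t}
    (h : HasGerm (liftHom hE c ≫ proj hE j) t U s b) :
    HasGerm (c.π.app j).toHom t U s b := by
  obtain ⟨h, rfl⟩ := h
  refine ⟨h, ?_⟩
  refine GermRel.unique hE ?_ (germRel_liftSection hE c ((Opens.map (coord F j)).obj U)
    (pullbackSection hE j U s) t h)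
  exact ⟨j, U, s, ⟨_, rfl⟩, ⟨h, rfl⟩⟩

lemma isLocalHom_liftHom (t : c.pt) : IsLocalHom ((liftHom hE c).stalkMap t).hom := by
  refine ⟨fun σ hσ ↦ ?_⟩
  obtain ⟨j, U, s, h, rfl⟩ := exists_hasGerm hE (liftBase c t) σ
  have h1 : HasGerm (liftHom hE c ≫ proj hE j) t U s
      ((liftHom hE c).stalkMap t (pullbackGerm (proj hE j) (liftBase c t) U h s)) := by
    exact ⟨h, pullbackGerm_comp_eq_stalkMap _ _ _ _ _ _⟩
  obtain ⟨h2, h3⟩ := hasGerm_liftHom_proj hE c h1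
  rw [pullbackGerm_eq] at h3
  replace hσ : IsUnit ((liftHom hE c).stalkMap t
    (pullbackGerm (proj hE j) (liftBase c t) U h s)) := hσ
  rw [← h3] at hσ
  have := (isUnit_map_iff ((c.π.app j).stalkMap t).hom _).mp hσ
  exact (congrArg IsUnit (pullbackGerm_eq (proj hE j) (liftBase c t) U h s)).mpr
    (this.map ((proj hE j).stalkMap (liftBase c t)).hom)

/-- The morphism from the vertex of a cone to the limit. -/
def limitLift : c.pt ⟶ limitSpace hE where
  toHom := liftHom hE c
  prop := isLocalHom_liftHom hE c

end lift

/-- The limit cone is a limit cone. -/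
def isLimitLimitCone : IsLimit (limitCone hE) where
  lift c := limitLift hE c
  fac c j := by
    refine hom_ext_of_hasGerm _ _ (fun t ↦ rfl) fun t U s h ↦ ⟨_, ⟨h, rfl⟩, ?_⟩
    exact hasGerm_liftHom_proj hE c ⟨h, rfl⟩
  uniq c m hm := by
    have hb : ∀ t, m.base t = liftBase c t := fun t ↦ Subtype.ext (funext fun j ↦ by
      change (m ≫ (limitCone hE).π.app j).base t = (c.π.app j).base t
      rw [hm])
    refine hom_ext_of_hasGerm _ _ hb fun t U s h ↦ ?_
    have h' : liftBase c t ∈ U := hb t ▸ h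
    refine ⟨_, ⟨h, rfl⟩, h', ?_⟩
    refine GermRel.unique hE (germRel_liftSection hE c U s t h') ?_
    obtain ⟨j, V, s', hV, e⟩ := exists_hasGerm hE (m.base t)
      ((space E p).presheaf.germ U (m.base t) h s)
    refine ⟨j, V, s', ?_, ?_⟩
    · convert hasGerm_evalStalk hE ⟨hV, e⟩ using 1
      refine Eq.trans ?_ (evalStalk_germ (m.base t) U h s).symm
      exact congrArg s.1 (Subtype.ext (hb t).symm)
    · rw [← hm j]
      refine ⟨hV, ?_⟩
      refine (pullbackGerm_comp_eq_stalkMap m.toHom (proj hE j) t V hV s').trans ?_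
      refine (congrArg (m.toHom.stalkMap t) e).trans ?_
      exact (pullbackGerm_eq m.toHom t U h s).symm

end GenericLimit

end AlgebraicGeometry.LocallyRingedSpace

/-! ### Generic points and birational maps -/

namespace ZariskiRiemann

variable {K : Type u} [Field K] {X Y Z S : Scheme.{u}}

/-- A morphism from the spectrum of a field is a *generic point* of an integral scheme if it
identifies the field with the function field. -/
structure IsGenericPoint (η : Spec (.of K) ⟶ X) : Prop where
  isDominant : IsDominant η
  isPreimmersion : IsPreimmersion η

/-- The point in the image of a morphism from the spectrum of a field. -/
abbrev imagePoint (η : Spec (.of K) ⟶ X) : X := η (IsLocalRing.closedPoint K)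

lemma imagePoint_comp (η : Spec (.of K) ⟶ X) (f : X ⟶ Y) :
    imagePoint (η ≫ f) = f (imagePoint η) :=
  rfl

lemma range_eq_singleton (η : Spec (.of K) ⟶ X) : Set.range η = {imagePoint η} := by
  ext x
  constructor
  · rintro ⟨y, rfl⟩
    exact congrArg η (Subsingleton.elim (α := PrimeSpectrum K) y _)
  · rintro rfl
    exact ⟨_, rfl⟩

lemma closure_imagePoint (η : Spec (.of K) ⟶ X) [IsDominant η] :
    closure {imagePoint η} = Set.univ := by
  rw [← range_eq_singleton]
  exact η.denseRange.closure_range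

lemma imagePoint_mem (η : Spec (.of K) ⟶ X) [IsDominant η] (U : X.Opens) {x : X} (hx : x ∈ U) :
    imagePoint η ∈ U := by
  have : imagePoint η ⤳ x := by
    rw [specializes_iff_mem_closure, closure_imagePoint]
    trivial
  exact this.mem_open U.2 hx

lemma isDominant_of_mem (η : Spec (.of K) ⟶ X)
    (h : ∀ (U : X.Opens) (x : X), x ∈ U → imagePoint η ∈ U) : IsDominant η := by
  refine ⟨dense_iff_inter_open.mpr fun U hU ⟨x, hx⟩ ↦ ?_⟩
  exact ⟨_, h ⟨U, hU⟩ x hx, ⟨_, rfl⟩⟩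

lemma exists_lift_opens (η : Spec (.of K) ⟶ X) [IsDominant η] (U : X.Opens) {x : X} (hx : x ∈ U) :
    ∃ η' : Spec (.of K) ⟶ U, η' ≫ U.ι = η ∧ IsDominant η' := by
  have h : Set.range η ⊆ Set.range U.ι := by
    rw [range_eq_singleton, Set.singleton_subset_iff, Scheme.Opens.range_ι]
    exact imagePoint_mem η U hx
  have e := IsOpenImmersion.lift_fac U.ι η h
  refine ⟨IsOpenImmersion.lift U.ι η h, e, ?_⟩
  have : IsDominant (IsOpenImmersion.lift U.ι η h ≫ U.ι) := by rwa [e]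
  exact .of_comp_of_isOpenImmersion _ U.ι

lemma IsGenericPoint.exists_lift_opens {η : Spec (.of K) ⟶ X} (hη : IsGenericPoint η)
    (U : X.Opens) {x : X} (hx : x ∈ U) :
    ∃ η' : Spec (.of K) ⟶ U, η' ≫ U.ι = η ∧ IsGenericPoint η' := by
  have := hη.isDominant
  have := hη.isPreimmersion
  obtain ⟨η', h, h'⟩ := ZariskiRiemann.exists_lift_opens η U hx
  have : IsPreimmersion (η' ≫ U.ι) := by rwa [h]
  exact ⟨η', h, h', .of_comp η' U.ι⟩

lemma IsGenericPoint.comp_isOpenImmersion {η : Spec (.of K) ⟶ X} (hη : IsGenericPoint η)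
    (f : X ⟶ Y) [IsOpenImmersion f] [IsDominant f] : IsGenericPoint (η ≫ f) := by
  have := hη.isDominant
  have := hη.isPreimmersion
  exact ⟨inferInstance, inferInstance⟩

lemma exists_isGenericPoint (X : Scheme.{u}) [IsIntegral X] :
    ∃ (K : Type u) (_ : Field K) (η : Spec (.of K) ⟶ X), IsGenericPoint η := by
  refine ⟨X.functionField, inferInstance, X.fromSpecStalk (genericPoint X), ⟨?_, ?_⟩⟩
  · refine ⟨dense_iff_inter_open.mpr fun U hU ⟨x, hx⟩ ↦ ⟨genericPoint X, ?_, ?_⟩⟩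
    · exact ((genericPoint_spec X).specializes trivial).mem_open hU hx
    · rw [Scheme.range_fromSpecStalk]
      exact specializes_rfl
  · exact inferInstanceAs (IsPreimmersion (X.fromSpecStalk (genericPoint X)))

/-- The stalk at a dominant point of an integral scheme is a field, so the map to `K` is injective.
A preimmersion is surjective on stalks. -/
lemma isIso_stalkClosedPointTo [IsIntegral X] {η : Spec (.of K) ⟶ X} (hη : IsGenericPoint η) :
    IsIso (Scheme.stalkClosedPointTo (R := .of K) η) := by
  have := hη.isDominant
  have := hη.isPreimmersion
  have hF : IsField (X.presheaf.stalk (imagePoint η)) :=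
    isField_stalk_of_closure_mem_irreducibleComponents X _ (by
      rw [closure_imagePoint, irreducibleComponents_eq_singleton]
      rfl)
  let := hF.toField
  refine (ConcreteCategory.isIso_iff_bijective _).mpr ⟨?_, ?_⟩
  · exact RingHom.injective
      (Scheme.stalkClosedPointTo (R := .of K) η).hom
  · have h1 := η.stalkMap_surjective (IsLocalRing.closedPoint K)
    have h2 : Function.Surjective (stalkClosedPointIso (CommRingCat.of K)).hom :=
      (ConcreteCategory.bijective_of_isIso _).2
    exact h2.comp h1

/-- Up to isomorphism `η` is the inclusion of the spectrum of the generic stalk, and a morphism from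
a stalk to a scheme locally of finite type extends to a neighbourhood. -/
lemma exists_spread_out [IsIntegral X] (sX : X ⟶ S) (sY : Y ⟶ S) [LocallyOfFiniteType sY]
    {η : Spec (.of K) ⟶ X} (hη : IsGenericPoint η) (θ : Spec (.of K) ⟶ Y)
    (h : η ≫ sX = θ ≫ sY) :
    ∃ (U : X.Opens) (η' : Spec (.of K) ⟶ U) (f : U.toScheme ⟶ Y), η' ≫ U.ι = η ∧ η' ≫ f = θ ∧
      f ≫ sY = U.ι ≫ sX := by
  have := isIso_stalkClosedPointTo hη
  have e := Scheme.Spec_stalkClosedPointTo_fromSpecStalk (R := .of K) η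
  set φ := Spec.map (Scheme.stalkClosedPointTo (R := .of K) η) with hφ
  have : IsIso φ := inferInstance
  obtain ⟨U, hU, f, h1, h2⟩ := spread_out_of_isGermInjective' sX sY (x := imagePoint η)
    (inv φ ≫ θ) (by
      rw [Category.assoc, ← h, ← Category.assoc, ← (IsIso.eq_inv_comp φ).mpr e])
  refine ⟨U, φ ≫ U.fromSpecStalkOfMem _ hU, f, ?_, ?_, h2⟩
  · rw [Category.assoc, Scheme.Opens.fromSpecStalkOfMem_ι, e]
  · rw [Category.assoc, ← h1, IsIso.hom_inv_id_assoc]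

/-- Spread the two points out to morphisms `f` and `g` in opposite directions. On `f ⁻¹ᵁ V` and `g
⁻¹ᵁ U` the composites agree with the inclusions at a dominant point, hence everywhere by reducedness
and separatedness, so `f` and `g` restrict to inverse isomorphisms. -/
theorem birationalOver_of_isGenericPoint [IsIntegral X] [IsIntegral Y] [X.IsSeparated]
    [Y.IsSeparated] (sX : X ⟶ S) (sY : Y ⟶ S) [LocallyOfFiniteType sX] [LocallyOfFiniteType sY]
    {η : Spec (.of K) ⟶ X} (hη : IsGenericPoint η) {θ : Spec (.of K) ⟶ Y}
    (hθ : IsGenericPoint θ) (h : η ≫ sX = θ ≫ sY) : Scheme.BirationalOver sX sY := by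
  obtain ⟨U, ηU, f, h1, h2, h3⟩ := exists_spread_out sX sY hη θ h
  obtain ⟨V, θV, g, h4, h5, h6⟩ := exists_spread_out sY sX hθ η h.symm
  have hη1 := hη.isDominant
  have hθ1 := hθ.isDominant
  have hx : imagePoint ηU ∈ f ⁻¹ᵁ V := by
    change f (imagePoint ηU) ∈ V
    rw [← imagePoint_comp, h2, ← h4, imagePoint_comp]
    exact Subtype.property _
  have hy : imagePoint θV ∈ g ⁻¹ᵁ U := by
    change g (imagePoint θV) ∈ U
    rw [← imagePoint_comp, h5, ← h1, imagePoint_comp]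
    exact Subtype.property _
  have hU : IsDominant ηU := by
    have : IsDominant (ηU ≫ U.ι) := by rwa [h1]
    exact .of_comp_of_isOpenImmersion _ U.ι
  have hV : IsDominant θV := by
    have : IsDominant (θV ≫ V.ι) := by rwa [h4]
    exact .of_comp_of_isOpenImmersion _ V.ι
  obtain ⟨ηA, hA, _⟩ := exists_lift_opens ηU (f ⁻¹ᵁ V) hx
  obtain ⟨θB, hB, _⟩ := exists_lift_opens θV (g ⁻¹ᵁ U) hy
  have : Nonempty U := ⟨imagePoint ηU⟩
  have : Nonempty V := ⟨imagePoint θV⟩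
  have : Nonempty (f ⁻¹ᵁ V) := ⟨⟨_, hx⟩⟩
  have : Nonempty (g ⁻¹ᵁ U) := ⟨⟨_, hy⟩⟩
  have hA2 : ηA ≫ f ∣_ V = θV := by
    rw [← cancel_mono V.ι, Category.assoc, morphismRestrict_ι, reassoc_of% hA, h2, h4]
  have hB2 : θB ≫ g ∣_ U = ηU := by
    rw [← cancel_mono U.ι, Category.assoc, morphismRestrict_ι, reassoc_of% hB, h5, h1]
  have e1 : f ∣_ V ≫ g = (f ⁻¹ᵁ V).ι ≫ U.ι :=
    ext_of_isDominant ηA (by rw [reassoc_of% hA2, h5, reassoc_of% hA, h1])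
  have e2 : g ∣_ U ≫ f = (g ⁻¹ᵁ U).ι ≫ V.ι :=
    ext_of_isDominant θB (by rw [reassoc_of% hB2, h2, reassoc_of% hB, h4])
  have r1 : Set.range (f ∣_ V) ⊆ Set.range (g ⁻¹ᵁ U).ι := by
    rintro _ ⟨a, rfl⟩
    rw [Scheme.Opens.range_ι]
    change g ((f ∣_ V) a) ∈ U
    rw [← Scheme.Hom.comp_apply, e1, Scheme.Hom.comp_apply]
    exact Subtype.property _
  have r2 : Set.range (g ∣_ U) ⊆ Set.range (f ⁻¹ᵁ V).ι := by
    rintro _ ⟨a, rfl⟩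
    rw [Scheme.Opens.range_ι]
    change f ((g ∣_ U) a) ∈ V
    rw [← Scheme.Hom.comp_apply, e2, Scheme.Hom.comp_apply]
    exact Subtype.property _
  have l1 := IsOpenImmersion.lift_fac (g ⁻¹ᵁ U).ι (f ∣_ V) r1
  have l2 := IsOpenImmersion.lift_fac (f ⁻¹ᵁ V).ι (g ∣_ U) r2
  let e : (f ⁻¹ᵁ V).toScheme ≅ (g ⁻¹ᵁ U).toScheme :=
    { hom := IsOpenImmersion.lift (g ⁻¹ᵁ U).ι (f ∣_ V) r1
      inv := IsOpenImmersion.lift (f ⁻¹ᵁ V).ι (g ∣_ U) r2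
      hom_inv_id := by
        rw [← cancel_mono (f ⁻¹ᵁ V).ι, Category.assoc, l2, ← cancel_mono U.ι,
          Category.assoc,
          morphismRestrict_ι, reassoc_of% l1, e1, Category.id_comp]
      inv_hom_id := by
        rw [← cancel_mono (g ⁻¹ᵁ U).ι, Category.assoc, l1, ← cancel_mono V.ι, Category.assoc,
          morphismRestrict_ι, reassoc_of% l2, e2, Category.id_comp] }
  have dX : IsDominant ((f ⁻¹ᵁ V).ι ≫ U.ι) := by
    have : IsDominant (ηA ≫ (f ⁻¹ᵁ V).ι ≫ U.ι) := by rwa [reassoc_of% hA, h1]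
    exact .of_comp ηA _
  have dY : IsDominant ((g ⁻¹ᵁ U).ι ≫ V.ι) := by
    have : IsDominant (θB ≫ (g ⁻¹ᵁ U).ι ≫ V.ι) := by rwa [reassoc_of% hB, h4]
    exact .of_comp θB _
  have : IsIso e.hom := e.isIso_hom
  refine (Scheme.Hom.birationalOver ((f ⁻¹ᵁ V).ι ≫ U.ι) sX _ rfl).symm.trans
    ((Scheme.Hom.birationalOver e.hom (((g ⁻¹ᵁ U).ι ≫ V.ι) ≫ sY) _ ?_).trans
      (Scheme.Hom.birationalOver ((g ⁻¹ᵁ U).ι ≫ V.ι) sY _ rfl))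
  simp only [Category.assoc, e, reassoc_of% l1]
  rw [← h6, reassoc_of% e1]

lemma isBirational_iff {f : Z ⟶ Y} : IsBirational f ↔ Scheme.BirationalOver f (𝟙 Y) := by
  simp [IsBirational, Scheme.BirationalOver, Scheme.PartialIso.IsOver]

theorem isBirational_of_isGenericPoint [IsIntegral Z] [IsIntegral Y] [Z.IsSeparated]
    [Y.IsSeparated] (f : Z ⟶ Y) [LocallyOfFiniteType f]
    {η : Spec (.of K) ⟶ Z} (hη : IsGenericPoint η) (h : IsGenericPoint (η ≫ f)) :
    IsBirational f :=
  isBirational_iff.mpr (birationalOver_of_isGenericPoint f (𝟙 Y) hη h (by simp))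

lemma exists_isGenericPoint_of_birationalOver [Nonempty X] {sX : X ⟶ S} {sY : Y ⟶ S}
    (h : Scheme.BirationalOver sX sY) {η : Spec (.of K) ⟶ X} (hη : IsGenericPoint η) :
    ∃ θ : Spec (.of K) ⟶ Y, IsGenericPoint θ ∧ θ ≫ sY = η ≫ sX := by
  obtain ⟨p, hp⟩ := h
  obtain ⟨x, hx⟩ := p.dense_source.nonempty
  obtain ⟨η', h1, h2⟩ := hη.exists_lift_opens p.source hx
  have := Opens.isDominant_ι p.dense_target
  refine ⟨η' ≫ p.iso.hom ≫ p.target.ι, h2.comp_isOpenImmersion _, ?_⟩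
  rw [Category.assoc, Category.assoc, hp, reassoc_of% h1]

lemma IsBirational.exists_isGenericPoint [Nonempty Y] {f : Z ⟶ Y} (hf : IsBirational f)
    {θ : Spec (.of K) ⟶ Y} (hθ : IsGenericPoint θ) :
    ∃ η : Spec (.of K) ⟶ Z, IsGenericPoint η ∧ η ≫ f = θ := by
  simpa using exists_isGenericPoint_of_birationalOver (isBirational_iff.mp hf).symm hθ

lemma IsBirational.isGenericPoint_comp [Nonempty Z] {f : Z ⟶ Y} (hf : IsBirational f)
    {η : Spec (.of K) ⟶ Z} (hη : IsGenericPoint η) : IsGenericPoint (η ≫ f) := by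
  obtain ⟨θ, h, e⟩ := exists_isGenericPoint_of_birationalOver (isBirational_iff.mp hf) hη
  rwa [← e, Category.comp_id]

/-- Dominant points lie in the dense open on which `f` is a monomorphism. This gives the uniqueness
of lifts of generic points to models. -/
lemma IsBirational.cancel_isDominant [Nonempty Z] {f : Z ⟶ Y} (hf : IsBirational f)
    {η θ : Spec (.of K) ⟶ Z} [IsDominant η] [IsDominant θ] (h : η ≫ f = θ ≫ f) : η = θ := by
  obtain ⟨p, hp⟩ := hf
  obtain ⟨x, hx⟩ := p.dense_source.nonempty
  obtain ⟨η', h1, -⟩ := ZariskiRiemann.exists_lift_opens η p.source hx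
  obtain ⟨θ', h2, -⟩ := ZariskiRiemann.exists_lift_opens θ p.source hx
  rw [← h1, ← h2, Category.assoc, Category.assoc, ← hp, ← Category.assoc, ← Category.assoc,
    cancel_mono, cancel_mono] at h
  rw [← h1, h, h2]

end ZariskiRiemann

/-! ### Ring-valued points of Proj -/

namespace ZariskiRiemann

section ProjPoints

open HomogeneousLocalization

variable {σ : Type*} {A : Type u} [CommRing A] [SetLike σ A] [AddSubgroupClass σ A]
  (𝒜 : ℕ → σ) [GradedRing 𝒜] {R S : Type u} [CommRing R] [CommRing S]

/-- The ring homomorphism `(A_f)₀ → R` induced by `g : A → R` when `g f` is a unit. -/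
def awayEval {f : A} (g : A →+* R) (h : IsUnit (g f)) : Away 𝒜 f →+* R :=
  (IsLocalization.Away.lift (S := Localization.Away f) f h).comp (algebraMap _ _)

lemma awayEval_mk_mul {f : A} (g : A →+* R) (h : IsUnit (g f)) {d : ℕ} (hf : f ∈ 𝒜 d) (n : ℕ)
    (x : A) (hx : x ∈ 𝒜 (n • d)) : awayEval 𝒜 g h (Away.mk 𝒜 hf n x hx) * g f ^ n = g x := by
  have : Localization.mk x (⟨f ^ n, n, rfl⟩ : Submonoid.powers f) * algebraMap A (Localization.Away f) (f ^ n) =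
      algebraMap A (Localization.Away f) x := by
    rw [Localization.mk_eq_mk']
    exact IsLocalization.mk'_spec _ x (⟨f ^ n, n, rfl⟩ : Submonoid.powers f)
  have := congrArg (IsLocalization.Away.lift (S := Localization.Away f) f h) this
  rw [map_mul, IsLocalization.Away.lift_eq, IsLocalization.Away.lift_eq, map_pow] at this
  exact this

lemma ringHom_away_ext {f : A} {d : ℕ} (hf : f ∈ 𝒜 d) {φ : Away 𝒜 f →+* R} (g : A →+* R)
    (h : IsUnit (g f))
    (H : ∀ (n : ℕ) (x : A) (hx : x ∈ 𝒜 (n • d)), φ (Away.mk 𝒜 hf n x hx) * g f ^ n = g x) :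
    φ = awayEval 𝒜 g h := by
  ext z
  obtain ⟨n, x, hx, rfl⟩ := Away.mk_surjective 𝒜 hf z
  exact (h.pow n).mul_left_injective ((H n x hx).trans (awayEval_mk_mul 𝒜 g h hf n x hx).symm)

lemma comp_awayEval {f : A} (g : A →+* R) (h : IsUnit (g f)) (e : R →+* S) :
    e.comp (awayEval 𝒜 g h) = awayEval 𝒜 (e.comp g) (h.map e) := by
  rw [awayEval, awayEval, ← RingHom.comp_assoc]
  congr 1
  apply IsLocalization.ringHom_ext (M := .powers f)
  ext x
  simp

variable {f : A} {m : ℕ} (hf : f ∈ 𝒜 m) (hm : 0 < m)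

/-- The `R`-valued point of `Proj A` given by a ring homomorphism `g : A → R` such that `g f` is a
unit. -/
def evalPoint (g : A →+* R) (h : IsUnit (g f)) : Spec (.of R) ⟶ Proj 𝒜 :=
  Spec.map (CommRingCat.ofHom (awayEval 𝒜 g h)) ≫ Proj.awayι 𝒜 f hf hm

lemma specMap_evalPoint (g : A →+* R) (h : IsUnit (g f)) (e : R →+* S) :
    Spec.map (CommRingCat.ofHom e) ≫ evalPoint 𝒜 hf hm g h =
      evalPoint 𝒜 hf hm (e.comp g) (h.map e) := by
  rw [evalPoint, evalPoint, ← Category.assoc, ← Spec.map_comp, ← CommRingCat.ofHom_comp,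
    comp_awayEval]

lemma evalPoint_toSpecZero (g : A →+* R) (h : IsUnit (g f)) :
    evalPoint 𝒜 hf hm g h ≫ Proj.toSpecZero 𝒜 =
      Spec.map (CommRingCat.ofHom (g.comp (algebraMap (𝒜 0) A))) := by
  rw [evalPoint, Category.assoc, Proj.awayι_toSpecZero, ← Spec.map_comp, ← CommRingCat.ofHom_comp]
  have H : (awayEval 𝒜 g h).comp (fromZeroRingHom 𝒜 _) = g.comp (algebraMap (𝒜 0) A) := by
    refine RingHom.ext fun x ↦ ?_
    have hx : (x : A) ∈ 𝒜 (0 • m) := by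
      rw [zero_smul]
      exact x.2
    have e : fromZeroRingHom 𝒜 (.powers f) x = Away.mk 𝒜 hf 0 (x : A) hx := by
      apply HomogeneousLocalization.val_injective
      rw [Away.val_mk]
      exact Localization.mk_eq_mk_iff.mpr (Localization.r_of_eq (by simp))
    rw [RingHom.comp_apply, e]
    have := awayEval_mk_mul 𝒜 g h hf 0 (x : A) hx
    rwa [pow_zero, mul_one] at this
  rw [H]

lemma evalPoint_mul {f' : A} {m' : ℕ} (hf' : f' ∈ 𝒜 m') (g : A →+* R) (h : IsUnit (g f))
    (h' : IsUnit (g (f * f'))) :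
    evalPoint 𝒜 (SetLike.mul_mem_graded hf hf') (hm.trans_le (m.le_add_right m')) g h' =
      evalPoint 𝒜 hf hm g h := by
  rw [evalPoint, evalPoint, ← Proj.SpecMap_awayMap_awayι 𝒜 hf hm hf' rfl, ← Category.assoc,
    ← Spec.map_comp, ← CommRingCat.ofHom_comp]
  congr 3
  refine ringHom_away_ext 𝒜 hf g h fun n x hx ↦ ?_
  have := awayEval_mk_mul 𝒜 g h' (SetLike.mul_mem_graded hf hf') n (x * f' ^ n)
    (by rw [smul_add]; exact SetLike.mul_mem_graded hx (SetLike.pow_mem_graded n hf'))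
  rw [RingHom.comp_apply, awayMap_mk]
  have hu : IsUnit (g f' ^ n) := by
    rw [map_mul] at h'
    exact (isUnit_of_mul_isUnit_right h').pow n
  refine hu.mul_left_injective ?_
  simp only [map_mul, map_pow, mul_pow] at this ⊢
  rw [mul_assoc]
  exact this

lemma evalPoint_eq {f' : A} {m' : ℕ} (hf' : f' ∈ 𝒜 m') (hm' : 0 < m') (g : A →+* R)
    (h : IsUnit (g f)) (h' : IsUnit (g f')) :
    evalPoint 𝒜 hf hm g h = evalPoint 𝒜 hf' hm' g h' := by
  have H : IsUnit (g (f * f')) := by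
    rw [map_mul]
    exact h.mul h'
  have H' : IsUnit (g (f' * f)) := by rwa [mul_comm]
  rw [← evalPoint_mul 𝒜 hf hm hf' g h H, ← evalPoint_mul 𝒜 hf' hm' hf g h' H']
  congr 1
  all_goals simp only [mul_comm, add_comm]

/-- In a degree-zero fraction numerator and denominator are scaled by the same power of `u`. -/
lemma evalPoint_congr {g g' : A →+* R} (h : IsUnit (g f)) (h' : IsUnit (g' f)) (u : R)
    (hu : ∀ (d : ℕ) (x : A), x ∈ 𝒜 d → g' x = u ^ d * g x) :
    evalPoint 𝒜 hf hm g h = evalPoint 𝒜 hf hm g' h' := by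
  rw [evalPoint, evalPoint]
  congr 3
  refine ringHom_away_ext 𝒜 hf g' h' fun n x hx ↦ ?_
  have := awayEval_mk_mul 𝒜 g h hf n x hx
  rw [hu _ _ hf, hu _ _ hx, ← this]
  rw [smul_eq_mul]
  ring

/-- In the chart of `f`, the open set of `f'` is the nonvanishing locus of `f' ^ m / f ^ m'`, which
evaluates to zero when `g f'` does. -/
lemma isUnit_of_evalPoint_mem {K : Type u} [Field K] {g : A →+* K} (h : IsUnit (g f)) {f' : A}
    {m' : ℕ} (hf' : f' ∈ 𝒜 m') (hm' : 0 < m')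
    (H : imagePoint (evalPoint 𝒜 hf hm g h) ∈ Proj.basicOpen 𝒜 f') : IsUnit (g f') := by
  rw [evalPoint, imagePoint_comp] at H
  have H' : imagePoint (Spec.map (CommRingCat.ofHom (awayEval 𝒜 g h))) ∈
    Proj.awayι 𝒜 f hf hm ⁻¹ᵁ Proj.basicOpen 𝒜 f' := H
  rw [Proj.awayι_preimage_basicOpen 𝒜 hf hm hf' hm'] at H'
  have H2 : awayEval 𝒜 g h (Away.isLocalizationElem hf hf') ≠ 0 := fun e ↦
    H' (by
      change awayEval 𝒜 g h (Away.isLocalizationElem hf hf') ∈ IsLocalRing.maximalIdeal K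
      rw [e]
      exact zero_mem _)
  refine isUnit_iff_ne_zero.mpr fun e ↦ H2 ?_
  have := awayEval_mk_mul 𝒜 g h hf m' (f' ^ m)
    (by convert SetLike.pow_mem_graded m hf' using 2; exact mul_comm _ _)
  rw [map_pow, e, zero_pow hm.ne'] at this
  exact (mul_eq_zero.mp this).resolve_right (h.pow _).ne_zero

end ProjPoints

end ZariskiRiemann

/-! ### Homogeneous coordinates on projective space -/

namespace ZariskiRiemann

section ProjectiveSpace

attribute [local instance] MvPolynomial.gradedAlgebra

open MvPolynomial HomogeneousLocalization

variable {k R S : Type u} [Field k] [CommRing R] [CommRing S] {n : ℕ}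

lemma eval₂_mul_of_isHomogeneous {τ : Type*} (c : k →+* R) (u : R) (a : τ → R)
    {p : MvPolynomial τ k} {d : ℕ} (hp : p.IsHomogeneous d) :
    p.eval₂ c (fun i ↦ u * a i) = u ^ d * p.eval₂ c a := by
  rw [eval₂_eq, eval₂_eq, Finset.mul_sum]
  refine Finset.sum_congr rfl fun s hs ↦ ?_
  rw [hp.degree_eq_sum_deg_support hs, ← Finset.prod_pow_eq_pow_sum]
  simp only [mul_pow, Finset.prod_mul_distrib]
  ring

lemma X_mem (k : Type u) [Field k] {n : ℕ} (i : Fin (n + 1)) :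
    (X i : MvPolynomial (Fin (n + 1)) k) ∈ homogeneousSubmodule (Fin (n + 1)) k 1 :=
  (mem_homogeneousSubmodule _ _).mpr (isHomogeneous_X k i)

/-- The `R`-valued point of projective space with homogeneous coordinates `a`, where `a i` is a
unit and `k` acts on `R` through `c`. -/
def coordPoint (c : k →+* R) (a : Fin (n + 1) → R) (i : Fin (n + 1)) (h : IsUnit (a i)) :
    Spec (.of R) ⟶ projSpace k n :=
  evalPoint (homogeneousSubmodule (Fin (n + 1)) k) (X_mem k i) one_pos
    (eval₂Hom c a) (by simpa using h)

lemma specMap_coordPoint (c : k →+* R) (a : Fin (n + 1) → R) (i : Fin (n + 1)) (h : IsUnit (a i))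
    (e : R →+* S) :
    Spec.map (CommRingCat.ofHom e) ≫ coordPoint c a i h =
      coordPoint (e.comp c) (e ∘ a) i (h.map e) := by
  refine (specMap_evalPoint _ _ _ _ _ _).trans ?_
  unfold coordPoint
  congr 1
  exact comp_eval₂Hom c a e

lemma coordPoint_projSpaceStr (c : k →+* R) (a : Fin (n + 1) → R) (i : Fin (n + 1))
    (h : IsUnit (a i)) : coordPoint c a i h ≫ projSpaceStr k n = Spec.map (CommRingCat.ofHom c) := by
  unfold coordPoint projSpaceStr
  refine (Category.assoc _ _ _).symm.trans ((congrArg (· ≫ Spec.map _)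
    (evalPoint_toSpecZero _ (X_mem k i) one_pos (eval₂Hom c a) (by simpa using h))).trans ?_)
  rw [← Spec.map_comp, ← CommRingCat.ofHom_comp]
  congr 2
  ext x
  exact eval₂Hom_C c a x

lemma coordPoint_index (c : k →+* R) (a : Fin (n + 1) → R) (i j : Fin (n + 1))
    (h : IsUnit (a i)) (h' : IsUnit (a j)) : coordPoint c a i h = coordPoint c a j h' :=
  evalPoint_eq _ _ _ _ _ _ _ _

lemma coordPoint_mul (c : k →+* R) (a : Fin (n + 1) → R) (i : Fin (n + 1)) (u : R)
    (h : IsUnit (a i)) (h' : IsUnit (u * a i)) :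
    coordPoint c a i h = coordPoint c (fun j ↦ u * a j) i h' :=
  evalPoint_congr _ _ _ _ _ u fun _ _ hx ↦ eval₂_mul_of_isHomogeneous c u a hx

lemma coordPoint_congr {c c' : k →+* R} {a a' : Fin (n + 1) → R} {i : Fin (n + 1)}
    {h : IsUnit (a i)} {h' : IsUnit (a' i)} (hc : c = c') (ha : a = a') :
    coordPoint c a i h = coordPoint c' a' i h' := by
  subst hc ha
  rfl

/-- The standard open immersion of the chart where the `i`-th coordinate does not vanish. -/
def chart (k : Type u) [Field k] {n : ℕ} (i : Fin (n + 1)) :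
    Spec (.of (Away (homogeneousSubmodule (Fin (n + 1)) k) (X i))) ⟶ projSpace k n :=
  Proj.awayι (homogeneousSubmodule (Fin (n + 1)) k) (X i) (X_mem k i) one_pos

instance {k : Type u} [Field k] {n : ℕ} (i : Fin (n + 1)) : IsOpenImmersion (chart k i) :=
  inferInstanceAs (IsOpenImmersion
    (Proj.awayι (homogeneousSubmodule (Fin (n + 1)) k) (X i) (X_mem k i) one_pos))

/-- The action of constants on the coordinate ring of a chart. -/
def chartConst (k : Type u) [Field k] {n : ℕ} (i : Fin (n + 1)) :
    k →+* Away (homogeneousSubmodule (Fin (n + 1)) k) (X i) :=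
  (fromZeroRingHom _ _).comp (algebraMap k (homogeneousSubmodule (Fin (n + 1)) k 0))

/-- The affine coordinate `X j / X i` on a chart. -/
def chartCoord (k : Type u) [Field k] {n : ℕ} (i j : Fin (n + 1)) :
    Away (homogeneousSubmodule (Fin (n + 1)) k) (X i) :=
  Away.mk _ (X_mem k i) 1 (X j) (by simpa using X_mem k j)

lemma chartCoord_self (i : Fin (n + 1)) : chartCoord k i i = 1 := by
  apply HomogeneousLocalization.val_injective
  rw [chartCoord, Away.val_mk, HomogeneousLocalization.val_one, Localization.mk_eq_mk']
  exact (IsLocalization.mk'_eq_iff_eq_mul).mpr (by simp)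

lemma chart_projSpaceStr (i : Fin (n + 1)) :
    chart k i ≫ projSpaceStr k n = Spec.map (CommRingCat.ofHom (chartConst k i)) := by
  unfold chart projSpaceStr
  refine (Category.assoc _ _ _).symm.trans ((congrArg (· ≫ Spec.map _)
    (Proj.awayι_toSpecZero _ _ (X_mem k i) one_pos)).trans ?_)
  rw [← Spec.map_comp, ← CommRingCat.ofHom_comp]
  rfl

lemma opensRange_chart (i : Fin (n + 1)) :
    (chart k i).opensRange = Proj.basicOpen (homogeneousSubmodule (Fin (n + 1)) k) (X i) :=
  Proj.opensRange_awayι _ _ (X_mem k i) one_pos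

lemma eval₂_chartCoord (i : Fin (n + 1)) {d : ℕ} {p : MvPolynomial (Fin (n + 1)) k}
    (hp : p.IsHomogeneous d) (hp' : p ∈ homogeneousSubmodule (Fin (n + 1)) k (d • 1)) :
    p.eval₂ (chartConst k i) (chartCoord k i) = Away.mk _ (X_mem k i) d p hp' := by
  apply HomogeneousLocalization.val_injective
  let L := Localization.Away (X i : MvPolynomial (Fin (n + 1)) k)
  let v : Away (homogeneousSubmodule (Fin (n + 1)) k) (X i) →+* L := algebraMap _ _
  let u : L := IsLocalization.mk' L (1 : MvPolynomial (Fin (n + 1)) k)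
    (⟨X i, 1, pow_one _⟩ : Submonoid.powers (X i : MvPolynomial (Fin (n + 1)) k))
  have hu : u * algebraMap _ L (X i) = 1 :=
    (IsLocalization.mk'_spec L _ _).trans (map_one _)
  have hmk (d : ℕ) (z : MvPolynomial (Fin (n + 1)) k) :
      Localization.mk z (⟨X i ^ d, d, rfl⟩ : Submonoid.powers (X i : MvPolynomial (Fin (n + 1)) k)) =
        u ^ d * algebraMap _ L z := by
    rw [Localization.mk_eq_mk']
    refine IsLocalization.mk'_eq_iff_eq_mul.mpr ?_
    change _ = _ * algebraMap _ L (X i ^ d)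
    rw [map_pow, mul_right_comm, ← mul_pow, hu, one_pow, one_mul]
  have h1 : v (p.eval₂ (chartConst k i) (chartCoord k i)) =
      p.eval₂ ((algebraMap (MvPolynomial (Fin (n + 1)) k) L).comp C)
        (fun j ↦ u * algebraMap (MvPolynomial (Fin (n + 1)) k) L (X j)) := by
    rw [hom_eval₂]
    have e1 : v.comp (chartConst k i) = (algebraMap (MvPolynomial (Fin (n + 1)) k) L).comp C :=
      RingHom.ext fun x ↦ Localization.mk_one_eq_algebraMap _
    have e2 : v ∘ chartCoord k i =
        fun j ↦ u * algebraMap (MvPolynomial (Fin (n + 1)) k) L (X j) := by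
      funext j
      exact ((Away.val_mk _ 1 (X_mem k i) (X j) _).trans (hmk 1 (X j))).trans (by rw [pow_one])
    rw [e1, ← e2]
    rfl
  refine h1.trans ?_
  rw [eval₂_mul_of_isHomogeneous _ _ _ hp]
  have h2 : p.eval₂ ((algebraMap (MvPolynomial (Fin (n + 1)) k) L).comp C)
      (fun j ↦ algebraMap (MvPolynomial (Fin (n + 1)) k) L (X j)) = algebraMap _ L p := by
    refine (hom_eval₂ p C (algebraMap _ L) X).symm.trans ?_
    rw [eval₂_eta]
  rw [h2]
  refine Eq.trans ?_ (Away.val_mk _ d (X_mem k i) p hp').symm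
  exact (hmk d p).symm

/-- A homogeneous `p` of degree `d` evaluated at the fractions `X j / X i` is `p / X i ^ d`
(`eval₂_chartCoord`), so a point of the chart has the values of these fractions as homogeneous
coordinates. -/
lemma specMap_chart {i : Fin (n + 1)}
    (φ : Away (homogeneousSubmodule (Fin (n + 1)) k) (X i) →+* R) :
    Spec.map (CommRingCat.ofHom φ) ≫ chart k i =
      coordPoint (φ.comp (chartConst k i)) (φ ∘ chartCoord k i) i
        (by rw [Function.comp_apply, chartCoord_self, map_one]; exact isUnit_one) := by
  unfold coordPoint chart evalPoint
  congr 3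
  refine ringHom_away_ext _ (X_mem k i) _ _ fun d p hp ↦ ?_
  have hp' : p.IsHomogeneous d := by simpa using hp
  rw [← eval₂_chartCoord i hp' hp, hom_eval₂]
  simp [chartCoord_self, Function.comp_def]

lemma exists_mem_chart (x : projSpace k n) : ∃ i, x ∈ (chart k i).opensRange := by
  have H : Algebra.adjoin (homogeneousSubmodule (Fin (n + 1)) k 0)
      (Set.range (X : Fin (n + 1) → MvPolynomial (Fin (n + 1)) k)) = ⊤ := by
    refine eq_top_iff.mpr fun p _ ↦ ?_
    induction p using MvPolynomial.induction_on with
    | C a =>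
      exact Subalgebra.algebraMap_mem _ (algebraMap k (homogeneousSubmodule (Fin (n + 1)) k 0) a)
    | add p q hp hq => exact add_mem (hp trivial) (hq trivial)
    | mul_X p i hp => exact mul_mem (hp trivial) (Algebra.subset_adjoin ⟨i, rfl⟩)
  have h := Proj.iSup_basicOpen_eq_top' (homogeneousSubmodule (Fin (n + 1)) k) X
    (fun i ↦ ⟨1, X_mem k i⟩) H
  have hx : x ∈ ⨆ i, Proj.basicOpen (homogeneousSubmodule (Fin (n + 1)) k) (X i) := by
    rw [h]
    trivial
  obtain ⟨i, hi⟩ := TopologicalSpace.Opens.mem_iSup.mp hx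
  exact ⟨i, (opensRange_chart i).ge hi⟩

lemma isUnit_of_mem_chart {K : Type u} [Field K] (c : k →+* K) (a : Fin (n + 1) → K)
    (i j : Fin (n + 1)) (h : IsUnit (a i))
    (H : imagePoint (coordPoint c a i h) ∈ (chart k j).opensRange) : IsUnit (a j) := by
  simpa using isUnit_of_evalPoint_mem _ (X_mem k i) one_pos _ (X_mem k j) one_pos
    ((opensRange_chart j).le H)

lemma exists_coordPoint {K : Type u} [Field K] (x : Spec (.of K) ⟶ projSpace k n) (c : k →+* K)
    (hx : x ≫ projSpaceStr k n = Spec.map (CommRingCat.ofHom c)) :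
    ∃ (a : Fin (n + 1) → K) (i : Fin (n + 1)) (h : IsUnit (a i)), x = coordPoint c a i h := by
  obtain ⟨i, hi⟩ := exists_mem_chart (imagePoint x)
  have hr : Set.range x ⊆ Set.range (chart k i) := by
    rw [range_eq_singleton]
    exact Set.singleton_subset_iff.mpr hi
  obtain ⟨φ, hφ⟩ := Spec.map_surjective (IsOpenImmersion.lift (chart k i) x hr)
  have e := IsOpenImmersion.lift_fac (chart k i) x hr
  rw [← hφ] at e
  have e' : x = Spec.map (CommRingCat.ofHom φ.hom) ≫ chart k i := e.symm
  have hc : φ.hom.comp (chartConst k i) = c := by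
    rw [e', Category.assoc, chart_projSpaceStr, ← Spec.map_comp, ← CommRingCat.ofHom_comp] at hx
    exact congrArg CommRingCat.Hom.hom (Spec.map_injective hx)
  refine ⟨φ.hom ∘ chartCoord k i, i, ?_, ?_⟩
  · rw [Function.comp_apply, chartCoord_self, map_one]
    exact isUnit_one
  · rw [e', specMap_chart]
    exact coordPoint_congr hc rfl

end ProjectiveSpace

end ZariskiRiemann

/-! ### Extending morphisms from a dense point -/

namespace ZariskiRiemann

section Extension

variable {K : Type u} [Field K] {X Z P T W : Scheme.{u}}

/-- The dense point lifts to every overlap of the local extensions and is dominant there, so they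
agree on overlaps and glue. -/
lemma exists_extension [IsIntegral Z] [T.IsSeparated] (η : Spec (.of K) ⟶ Z) [IsDominant η]
    (t : Spec (.of K) ⟶ T)
    (h : ∀ z : Z, ∃ (U : Scheme.{u}) (j : U ⟶ Z) (_ : IsOpenImmersion j) (f : U ⟶ T)
      (η' : Spec (.of K) ⟶ U), z ∈ Set.range j ∧ η' ≫ j = η ∧ η' ≫ f = t) :
    ∃ F : Z ⟶ T, η ≫ F = t := by
  choose U j hj f η' hz hη hf using h
  let 𝒰 : Z.OpenCover :=
    { I₀ := Z
      X := U
      f := j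
      mem₀ := by
        rw [Scheme.presieve₀_mem_precoverage_iff]
        exact ⟨fun z ↦ ⟨z, hz z⟩, hj⟩ }
  have hd (V : Scheme.{u}) (i : V ⟶ Z) [IsOpenImmersion i] (l : Spec (.of K) ⟶ V)
      (hl : l ≫ i = η) : IsReduced V ∧ IsDominant l := by
    have : IsDominant (l ≫ i) := by rwa [hl]
    exact ⟨isReduced_of_isOpenImmersion i, .of_comp_of_isOpenImmersion l i⟩
  have hf' (a b : Z) : pullback.fst (j a) (j b) ≫ f a = pullback.snd (j a) (j b) ≫ f b := by
    let l := pullback.lift (f := j a) (g := j b) (η' a) (η' b) ((hη a).trans (hη b).symm)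
    have := hj a
    have := hj b
    obtain ⟨_, _⟩ := hd _ (pullback.fst (j a) (j b) ≫ j a) l (by
      rw [pullback.lift_fst_assoc, hη])
    refine ext_of_isDominant l ?_
    rw [pullback.lift_fst_assoc, pullback.lift_snd_assoc, hf, hf]
  refine ⟨𝒰.glueMorphisms f hf', ?_⟩
  obtain ⟨z⟩ : Nonempty Z := inferInstance
  rw [← hη z, Category.assoc, ← hf z]
  exact congrArg (η' z ≫ ·) (𝒰.ι_glueMorphisms f hf' z)

/-- The base change of `i` along `F` is a closed immersion with dense image in a reduced scheme,
hence an isomorphism. -/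
lemma exists_factor_of_isClosedImmersion [IsReduced Z] (i : X ⟶ P) [IsClosedImmersion i]
    (F : Z ⟶ P) (η : Spec (.of K) ⟶ Z) [IsDominant η] (x : Spec (.of K) ⟶ X)
    (h : η ≫ F = x ≫ i) : ∃ p : Z ⟶ X, p ≫ i = F ∧ η ≫ p = x := by
  let l := pullback.lift (f := i) (g := F) x η h.symm
  have hl : l ≫ pullback.snd i F = η := pullback.lift_snd _ _ _
  have : IsDominant (l ≫ pullback.snd i F) := by rwa [hl]
  have hdom : IsDominant (pullback.snd i F) := .of_comp l _
  have : Surjective (pullback.snd i F) :=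
    surjective_of_isDominant_of_isClosed_range _ (pullback.snd i F).isClosedEmbedding.isClosed_range
  have : IsIso (pullback.snd i F) := isIso_of_isClosedImmersion_of_surjective _
  have h1 : (inv (pullback.snd i F) ≫ pullback.fst i F) ≫ i = F := by
    rw [Category.assoc, pullback.condition, IsIso.inv_hom_id_assoc]
  refine ⟨inv (pullback.snd i F) ≫ pullback.fst i F, h1, ?_⟩
  rw [← cancel_mono i, Category.assoc, h1, h]

instance isSchemeTheoreticallyDominant_toImage (w : W ⟶ P) [QuasiCompact w] :
    IsSchemeTheoreticallyDominant w.toImage := by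
  refine ⟨eq_bot_iff.mpr (Scheme.IdealSheafData.le_of_iSup_eq_top
    (fun V : P.affineOpens ↦ ⟨w.imageι ⁻¹ᵁ V.1, V.2.preimage w.imageι⟩) ?_ fun V ↦ ?_)⟩
  · refine eq_top_iff.mpr fun z _ ↦ TopologicalSpace.Opens.mem_iSup.mpr ?_
    have : w.imageι z ∈ ⨆ V : P.affineOpens, V.1 := by
      rw [iSup_affineOpens_eq_top]
      trivial
    obtain ⟨V, hV⟩ := TopologicalSpace.Opens.mem_iSup.mp this
    exact ⟨V, hV⟩
  · rw [Scheme.Hom.ker_apply]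
    exact ((RingHom.injective_iff_ker_eq_bot _).mp (w.toImage_app_injective V)).le

lemma isIntegral_image [IsIntegral W] (w : W ⟶ P) [QuasiCompact w] : IsIntegral w.image := by
  have := IsSchemeTheoreticallyDominant.isReduced w.toImage
  have : IrreducibleSpace w.image := by
    have h := (IrreducibleSpace.isIrreducible_univ W).image w.toImage
      w.toImage.continuous.continuousOn
    rw [Set.image_univ] at h
    rw [irreducibleSpace_def]
    convert h.closure
    exact w.toImage.denseRange.closure_range.symm
  exact isIntegral_of_irreducibleSpace_of_isReduced _

end Extension

/-! ### The Segre join of two varieties -/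

section Join

attribute [local instance] MvPolynomial.gradedAlgebra

variable {k K : Type u} [Field k] [Field K] {n m N : ℕ}

instance (k : Type u) [Field k] (n : ℕ) : (projSpace k n).IsSeparated := by
  exact inferInstanceAs (Proj (MvPolynomial.homogeneousSubmodule (Fin (n + 1)) k)).IsSeparated

lemma exists_specMap_chart {R : Type u} [CommRing R] (c : k →+* R) (a : Fin (n + 1) → R)
    (i : Fin (n + 1)) (h : IsUnit (a i)) :
    ∃ φ : HomogeneousLocalization.Away (MvPolynomial.homogeneousSubmodule (Fin (n + 1)) k)
        (MvPolynomial.X i) →+* R,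
      φ.comp (chartConst k i) = c ∧ (∀ j, φ (chartCoord k i j) * a i = a j) ∧
        Spec.map (CommRingCat.ofHom φ) ≫ chart k i = coordPoint c a i h := by
  have hX : IsUnit (MvPolynomial.eval₂Hom c a (MvPolynomial.X i)) := by simpa using h
  let φ := awayEval (MvPolynomial.homogeneousSubmodule (Fin (n + 1)) k)
    (MvPolynomial.eval₂Hom c a) hX
  have e : Spec.map (CommRingCat.ofHom φ) ≫ chart k i = coordPoint c a i h := rfl
  refine ⟨φ, ?_, fun j ↦ ?_, e⟩
  · have h1 := congrArg (· ≫ projSpaceStr k n) e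
    simp only [coordPoint_projSpaceStr, Category.assoc, chart_projSpaceStr, ← Spec.map_comp,
      ← CommRingCat.ofHom_comp] at h1
    exact congrArg CommRingCat.Hom.hom (Spec.map_injective h1)
  · have := awayEval_mk_mul (MvPolynomial.homogeneousSubmodule (Fin (n + 1)) k)
      (MvPolynomial.eval₂Hom c a) hX (X_mem k i) 1 (MvPolynomial.X j) (by simpa using X_mem k j)
    rw [pow_one, MvPolynomial.coe_eval₂Hom, MvPolynomial.eval₂_X, MvPolynomial.eval₂_X] at this
    exact this

/-- A selection `τ` of coordinates that contains `s` defines a linear projection without base points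
on the chart of `s`. The selection may vary with the chart; the local projections glue because they
all send the dense point to `x`. -/
lemma exists_projection {Z : Scheme.{u}} [IsIntegral Z] (i : Z ⟶ projSpace k N) (c : k →+* K)
    (η : Spec (.of K) ⟶ Z) [IsDominant η] (w : Fin (N + 1) → K) (s : Fin (N + 1))
    (hs : IsUnit (w s)) (h : η ≫ i = coordPoint c w s hs) (x : Spec (.of K) ⟶ projSpace k n)
    (H : ∀ s, IsUnit (w s) → ∃ (τ : Fin (n + 1) → Fin (N + 1)) (l : Fin (n + 1)) (_ : τ l = s)
      (hl : IsUnit ((w ∘ τ) l)), x = coordPoint c (w ∘ τ) l hl) :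
    ∃ F : Z ⟶ projSpace k n, η ≫ F = x := by
  refine exists_extension η x fun z ↦ ?_
  obtain ⟨r, hr⟩ := exists_mem_chart (i z)
  have h1 : imagePoint (η ≫ i) ∈ (chart k r).opensRange :=
    imagePoint_mem η (i ⁻¹ᵁ (chart k r).opensRange) (x := z) hr
  have hwr : IsUnit (w r) := isUnit_of_mem_chart c w s r hs (by rwa [← h])
  obtain ⟨τ, l, rfl, hl, rfl⟩ := H r hwr
  obtain ⟨φ, hc, hφ, e⟩ := exists_specMap_chart c w (τ l) hwr
  rw [coordPoint_index c w s (τ l) hs hwr, ← e] at h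
  let g : Spec (.of _) ⟶ projSpace k n :=
    coordPoint (chartConst k (τ l)) (chartCoord k (τ l) ∘ τ) l
      (by rw [Function.comp_apply, chartCoord_self]; exact isUnit_one)
  refine ⟨pullback i (chart k (τ l)), pullback.fst _ _, inferInstance,
    pullback.snd _ _ ≫ g, pullback.lift η _ h, ?_, pullback.lift_fst _ _ _, ?_⟩
  · rw [IsOpenImmersion.range_pullbackFst]
    exact hr
  · rw [pullback.lift_snd_assoc]
    rw [specMap_coordPoint]
    refine (coordPoint_mul _ _ l (w (τ l)) _ ?_).trans (coordPoint_congr hc ?_)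
    · rw [Function.comp_apply, Function.comp_apply, chartCoord_self, map_one, mul_one]
      exact hwr
    · funext j
      rw [Function.comp_apply, Function.comp_apply, mul_comm, hφ, Function.comp_apply]

/-- Any two projective varieties with a common field-valued point over `k` receive compatible
morphisms from a projective variety on which that point is dense. -/
theorem exists_join {X Y : Over (Spec (.of k))} (hX : IsProjectiveVariety X)
    (hY : IsProjectiveVariety Y) (x : Spec (.of K) ⟶ X.left) (y : Spec (.of K) ⟶ Y.left)
    (h : x ≫ X.hom = y ≫ Y.hom) :
    ∃ (Z : Over (Spec (.of k))) (_ : IsProjectiveVariety Z) (η : Spec (.of K) ⟶ Z.left)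
      (_ : IsDominant η) (p : Z ⟶ X) (q : Z ⟶ Y), η ≫ p.left = x ∧ η ≫ q.left = y := by
  obtain ⟨n, i, hi, hiX⟩ := hX.exists_closedImmersion
  obtain ⟨m, j, hj, hjY⟩ := hY.exists_closedImmersion
  obtain ⟨c, hc⟩ := Spec.map_surjective (x ≫ X.hom)
  have hcx : (x ≫ i) ≫ projSpaceStr k n = Spec.map (CommRingCat.ofHom c.hom) := by
    rw [Category.assoc, hiX, CommRingCat.ofHom_hom, hc]
  have hcy : (y ≫ j) ≫ projSpaceStr k m = Spec.map (CommRingCat.ofHom c.hom) := by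
    rw [Category.assoc, hjY, CommRingCat.ofHom_hom, hc, h]
  obtain ⟨a, r, hr, ha⟩ := exists_coordPoint _ _ hcx
  obtain ⟨b, s, hs, hb⟩ := exists_coordPoint _ _ hcy
  -- The Segre target: `(n + 1) * (m + 1) = (n * m + n + m) + 1`.
  obtain ⟨N, ⟨e⟩⟩ : ∃ N, Nonempty (Fin (n + 1) × Fin (m + 1) ≃ Fin (N + 1)) :=
    ⟨n * m + n + m, ⟨finProdFinEquiv.trans (finCongr (by ring))⟩⟩
  let w : Fin (N + 1) → K := fun t ↦ a (e.symm t).1 * b (e.symm t).2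
  have hw : IsUnit (w (e (r, s))) := by
    simpa [w] using And.intro hr.ne_zero hs.ne_zero
  let f := coordPoint c.hom w (e (r, s)) hw
  have := isIntegral_image f
  have hf : f.toImage ≫ f.imageι = f := f.toImage_imageι
  obtain ⟨F, hF⟩ := exists_projection f.imageι c.hom f.toImage w _ hw hf (x ≫ i) fun t ht ↦ by
    have ht' : IsUnit (a (e.symm t).1) ∧ IsUnit (b (e.symm t).2) := by
      simpa only [w, IsUnit.mul_iff] using ht
    -- Freezing the second index of a nonzero Segre coordinate leaves the vector `a` scaled by a
    -- unit entry of `b`, which is the same projective point.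
    refine ⟨fun l ↦ e (l, (e.symm t).2), (e.symm t).1, by simp, by simpa [w] using ht, ?_⟩
    rw [ha, coordPoint_index c.hom a r (e.symm t).1 hr ht'.1,
      coordPoint_mul c.hom a _ (b (e.symm t).2) ht'.1 (ht'.2.mul ht'.1)]
    exact coordPoint_congr rfl (by funext l; simp [w, mul_comm])
  obtain ⟨G, hG⟩ := exists_projection f.imageι c.hom f.toImage w _ hw hf (y ≫ j) fun t ht ↦ by
    have ht' : IsUnit (a (e.symm t).1) ∧ IsUnit (b (e.symm t).2) := by
      simpa only [w, IsUnit.mul_iff] using ht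
    refine ⟨fun l ↦ e ((e.symm t).1, l), (e.symm t).2, by simp, by simpa [w] using ht, ?_⟩
    rw [hb, coordPoint_index c.hom b s (e.symm t).2 hs ht'.2,
      coordPoint_mul c.hom b _ (a (e.symm t).1) ht'.2 (ht'.1.mul ht'.2)]
    exact coordPoint_congr rfl (by funext l; simp [w])
  obtain ⟨p, hp, hp'⟩ := exists_factor_of_isClosedImmersion i F f.toImage x hF
  obtain ⟨q, hq, hq'⟩ := exists_factor_of_isClosedImmersion j G f.toImage y hG
  have hstr : f.toImage ≫ f.imageι ≫ projSpaceStr k N = Spec.map c := by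
    rw [← Category.assoc, hf]
    exact coordPoint_projSpaceStr _ _ _ _
  have hpX : p ≫ X.hom = f.imageι ≫ projSpaceStr k N :=
    ext_of_isDominant f.toImage (by rw [reassoc_of% hp', ← hc, hstr])
  have hqY : q ≫ Y.hom = f.imageι ≫ projSpaceStr k N :=
    ext_of_isDominant f.toImage (by rw [reassoc_of% hq', ← h, ← hc, hstr])
  exact ⟨Over.mk (f.imageι ≫ projSpaceStr k N), ⟨this, N, f.imageι, inferInstance, rfl⟩,
    f.toImage, inferInstance, Over.homMk p hpX, Over.homMk q hqY, hp', hq'⟩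

end Join

end ZariskiRiemann

/-! ### The category of birational models -/

namespace ZariskiRiemann

section

variable {K : Type u} [Field K] {X Y Z S : Scheme.{u}}

lemma isPreimmersion_of_surjectiveOnStalks (η : Spec (.of K) ⟶ X) [SurjectiveOnStalks η] :
    IsPreimmersion η := by
  have : Subsingleton (Spec (.of K)) := inferInstanceAs (Subsingleton (PrimeSpectrum K))
  exact ⟨.of_subsingleton _⟩

/-- Surjectivity on stalks passes to the first factor of a composite, and a map from a one-point
space is automatically an embedding. -/
lemma IsGenericPoint.of_comp {η : Spec (.of K) ⟶ Z} [h : IsDominant η] (f : Z ⟶ Y)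
    (hf : IsGenericPoint (η ≫ f)) : IsGenericPoint η := by
  have := hf.isPreimmersion
  have : SurjectiveOnStalks η := .of_comp η f
  exact ⟨h, isPreimmersion_of_surjectiveOnStalks η⟩

lemma isBirational_of_isIso (f : Z ⟶ Y) [IsIso f] : IsBirational f :=
  isBirational_iff.mpr (Scheme.Hom.birationalOver f (𝟙 Y) f (Category.comp_id f))

end

section ProjectiveVariety

variable {k K : Type u} [Field k] [Field K] {X Y Z : Over (Spec (.of k))}

attribute [local instance] MvPolynomial.gradedAlgebra

lemma locallyOfFiniteType_projSpaceStr (k : Type u) [Field k] (n : ℕ) :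
    LocallyOfFiniteType (projSpaceStr k n) := by
  let 𝒜 := MvPolynomial.homogeneousSubmodule (Fin (n + 1)) k
  have : IsScalarTower k (𝒜 0) (MvPolynomial (Fin (n + 1)) k) :=
    .of_algebraMap_eq (R := k) (S := 𝒜 0) fun _ ↦ rfl
  have : Algebra.FiniteType (𝒜 0) (MvPolynomial (Fin (n + 1)) k) :=
    .of_restrictScalars_finiteType k _ _
  have h : LocallyOfFiniteType (Spec.map (CommRingCat.ofHom (algebraMap k (𝒜 0)))) := by
    rw [HasRingHomProperty.Spec_iff (P := @LocallyOfFiniteType)]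
    refine RingHom.FiniteType.of_surjective _ fun p ↦ ?_
    obtain ⟨p, hp⟩ := p
    have hp' : p.totalDegree = 0 := ((MvPolynomial.totalDegree_zero_iff_isHomogeneous _).mpr hp)
    exact ⟨p.coeff 0, Subtype.ext (MvPolynomial.totalDegree_eq_zero_iff_eq_C.mp hp').symm⟩
  exact MorphismProperty.comp_mem @LocallyOfFiniteType (Proj.toSpecZero 𝒜) _ inferInstance h

namespace IsProjectiveVariety

lemma isSeparated (hX : IsProjectiveVariety X) : X.left.IsSeparated := by
  obtain ⟨n, i, hi, -⟩ := hX.exists_closedImmersion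
  refine ⟨?_⟩
  rw [← terminal.comp_from i]
  infer_instance

lemma locallyOfFiniteType (hX : IsProjectiveVariety X) : LocallyOfFiniteType X.hom := by
  obtain ⟨n, i, hi, h⟩ := hX.exists_closedImmersion
  have := locallyOfFiniteType_projSpaceStr k n
  rw [← h]
  infer_instance

lemma locallyOfFiniteType_left (hX : IsProjectiveVariety X) (f : X ⟶ Y) :
    LocallyOfFiniteType f.left := by
  have := hX.locallyOfFiniteType
  rw [← Over.w f] at this
  exact locallyOfFiniteType_of_comp f.left Y.hom

end IsProjectiveVariety

theorem exists_join_isBirational (hX : IsProjectiveVariety X) (hY : IsProjectiveVariety Y)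
    {x : Spec (.of K) ⟶ X.left} (hx : IsGenericPoint x) {y : Spec (.of K) ⟶ Y.left}
    (hy : IsGenericPoint y) (h : x ≫ X.hom = y ≫ Y.hom) :
    ∃ (Z : Over (Spec (.of k))) (_ : IsProjectiveVariety Z) (η : Spec (.of K) ⟶ Z.left)
      (_ : IsGenericPoint η) (p : Z ⟶ X) (q : Z ⟶ Y), η ≫ p.left = x ∧ η ≫ q.left = y ∧
        IsBirational p.left ∧ IsBirational q.left := by
  obtain ⟨Z, hZ, η, hd, p, q, rfl, rfl⟩ := exists_join hX hY x y h
  have hη : IsGenericPoint η := .of_comp p.left hx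
  have := hX.isSeparated
  have := hY.isSeparated
  have := hZ.isSeparated
  have := hX.isIntegral
  have := hY.isIntegral
  have := hZ.isIntegral
  have := hZ.locallyOfFiniteType_left p
  have := hZ.locallyOfFiniteType_left q
  exact ⟨Z, hZ, η, hη, p, q, rfl, rfl, isBirational_of_isGenericPoint _ hη hx,
    isBirational_of_isGenericPoint _ hη hy⟩

end ProjectiveVariety

namespace BirationalModel

variable {k K : Type u} [Field k] [Field K] {X : Over (Spec (.of k))} {M N : BirationalModel X}

instance : IsIntegral M.Y.left := M.isProjectiveVariety.isIntegral

instance : M.Y.left.IsSeparated := M.isProjectiveVariety.isSeparated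

lemma exists_isGenericPoint [IsIntegral X.left] {η : Spec (.of K) ⟶ X.left} (hη : IsGenericPoint η)
    (M : BirationalModel X) :
    ∃ θ : Spec (.of K) ⟶ M.Y.left, IsGenericPoint θ ∧ θ ≫ M.π.left = η :=
  M.isBirational.exists_isGenericPoint hη

lemma Hom.left_fac (f : M ⟶ N) : (Hom.ν f).left ≫ N.π.left = M.π.left :=
  congrArg (fun g ↦ g.left) (Hom.fac f)

/-- Both points are dominant with the same image in `X`, so the birational map `N.π` cancels. Hence
the lifts of a generic point form a cone. -/
lemma comp_hom_left [IsIntegral X.left] {θ : Spec (.of K) ⟶ M.Y.left} (hθ : IsGenericPoint θ)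
    {θ' : Spec (.of K) ⟶ N.Y.left} (hθ' : IsGenericPoint θ')
    (h : θ ≫ M.π.left = θ' ≫ N.π.left) (f : M ⟶ N) : θ ≫ (Hom.ν f).left = θ' := by
  have := ((Hom.isBirational f).isGenericPoint_comp hθ).isDominant
  have := hθ'.isDominant
  refine N.isBirational.cancel_isDominant ?_
  rw [Category.assoc, Hom.left_fac, h]

lemma subsingleton_hom (hX : IsProjectiveVariety X) : Subsingleton (M ⟶ N) := by
  have := hX.isIntegral
  refine ⟨fun f g ↦ Hom.ext (Over.OverMorphism.ext ?_)⟩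
  obtain ⟨K, _, η, hη⟩ := ZariskiRiemann.exists_isGenericPoint X.left
  obtain ⟨θ, hθ, h⟩ := M.exists_isGenericPoint hη
  obtain ⟨θ', hθ', h'⟩ := N.exists_isGenericPoint hη
  have := hθ.isDominant
  refine ext_of_isDominant θ ?_
  rw [comp_hom_left hθ hθ' (h.trans h'.symm) f, comp_hom_left hθ hθ' (h.trans h'.symm) g]

lemma exists_join_models (hX : IsProjectiveVariety X) (M N : BirationalModel X) :
    ∃ L : BirationalModel X, Nonempty (L ⟶ M) ∧ Nonempty (L ⟶ N) := by
  have := hX.isIntegral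
  have := hX.isSeparated
  obtain ⟨K, _, η, hη⟩ := ZariskiRiemann.exists_isGenericPoint X.left
  obtain ⟨x, hx, hxη⟩ := M.exists_isGenericPoint hη
  obtain ⟨y, hy, hyη⟩ := N.exists_isGenericPoint hη
  obtain ⟨Z, hZ, θ, hθ, p, q, hp, hq, hp', hq'⟩ := exists_join_isBirational
    M.isProjectiveVariety N.isProjectiveVariety hx hy (by
      rw [← Over.w M.π, ← Over.w N.π, reassoc_of% hxη, reassoc_of% hyη])
  have := hZ.isIntegral
  have := hθ.isDominant
  refine ⟨⟨Z, hZ, p ≫ M.π, hp'.comp M.isBirational⟩, ⟨⟨p, rfl, hp'⟩⟩, ⟨⟨q, ?_, hq'⟩⟩⟩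
  refine Over.OverMorphism.ext (ext_of_isDominant θ ?_)
  change θ ≫ q.left ≫ N.π.left = θ ≫ p.left ≫ M.π.left
  rw [reassoc_of% hq, reassoc_of% hp, hyη, hxη]

lemma isCofiltered (hX : IsProjectiveVariety X) : IsCofiltered (BirationalModel X) where
  cone_objs M N := by
    obtain ⟨L, ⟨f⟩, ⟨g⟩⟩ := exists_join_models hX M N
    exact ⟨L, f, g, ⟨⟩⟩
  cone_maps M N f g := ⟨M, 𝟙 M, by rw [(subsingleton_hom hX).elim f g]⟩
  nonempty := ⟨trivial X hX⟩

/-- Pushing models forward along a birational morphism. -/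
def pushforward {Z : Over (Spec (.of k))} (p : Z ⟶ X) (hp : IsBirational p.left) :
    BirationalModel Z ⥤ BirationalModel X where
  obj M := ⟨M.Y, M.isProjectiveVariety, M.π ≫ p, M.isBirational.comp hp⟩
  map {M N} f := ⟨Hom.ν (Z := M) (Y := N) f,
    (Category.assoc _ _ _).symm.trans (congrArg (· ≫ p) (Hom.fac (Z := M) (Y := N) f)), Hom.isBirational (Z := M) (Y := N) f⟩
  map_id _ := rfl
  map_comp _ _ := rfl

/-- Any model of `X` is dominated by its join with `Z`, which is a model of `Z`. So restricting to
models over `Z` does not change the limit. -/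
lemma initial_pushforward {Z : Over (Spec (.of k))} (hX : IsProjectiveVariety X)
    (hZ : IsProjectiveVariety Z) (p : Z ⟶ X) (hp : IsBirational p.left) :
    (pushforward p hp).Initial := by
  have := isCofiltered hZ
  refine Functor.initial_of_exists_of_isCofiltered _ (fun N ↦ ?_)
    fun {d c} s s' ↦ ⟨c, 𝟙 c, by rw [(subsingleton_hom hX).elim s s']⟩
  obtain ⟨L, ⟨f⟩, ⟨g⟩⟩ := exists_join_models hX ((pushforward p hp).obj (trivial Z hZ)) N
  have hf : (Hom.ν f : L.Y ⟶ Z) ≫ p = L.π :=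
    (congrArg ((Hom.ν f : L.Y ⟶ Z) ≫ ·) (Category.id_comp p).symm).trans (Hom.fac f)
  refine ⟨⟨L.Y, L.isProjectiveVariety, (Hom.ν f : L.Y ⟶ Z), Hom.isBirational f⟩,
    ⟨⟨Hom.ν (Z := L) (Y := N) g, (Hom.fac (Z := L) (Y := N) g).trans hf.symm,
      Hom.isBirational (Z := L) (Y := N) g⟩⟩⟩

/-- An isomorphism of varieties compatible with the morphisms to `X` is an isomorphism of models. -/
def isoMk (e : M.Y ≅ N.Y) (h : e.hom ≫ N.π = M.π) : M ≅ N where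
  hom := ⟨e.hom, h, isBirational_of_isIso ((Over.forget _).map e.hom)⟩
  inv := ⟨e.inv, by rw [← h, e.inv_hom_id_assoc],
    isBirational_of_isIso ((Over.forget _).map e.inv)⟩
  hom_inv_id := Hom.ext e.hom_inv_id
  inv_hom_id := Hom.ext e.inv_hom_id

/-- A small type of data describing all models of `X` up to isomorphism. -/
def Data (X : Over (Spec (.of k))) : Type u :=
  Σ (n : ℕ) (I : (projSpace k n).IdealSheafData), I.subscheme ⟶ X.left

/-- The data `t` describe the model `M`. -/
def Describes (t : Data X) (M : BirationalModel X) : Prop :=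
  ∃ e : M.Y ≅ Over.mk (t.2.1.subschemeι ≫ projSpaceStr k t.1), e.hom.left ≫ t.2.2 = M.π.left

lemma exists_describes (M : BirationalModel X) : ∃ t, Describes t M := by
  obtain ⟨n, i, hi, h⟩ := M.isProjectiveVariety.exists_closedImmersion
  refine ⟨⟨n, i.ker, inv i.toImage ≫ M.π.left⟩, Over.isoMk (asIso i.toImage) ?_, ?_⟩
  · change i.toImage ≫ i.imageι ≫ projSpaceStr k n = M.Y.hom
    rw [i.toImage_imageι_assoc, h]
  · exact IsIso.hom_inv_id_assoc i.toImage M.π.left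

lemma nonempty_iso_of_describes {t : Data X} (hM : Describes t M) (hN : Describes t N) :
    Nonempty (M ≅ N) := by
  obtain ⟨e, he⟩ := hM
  obtain ⟨e', he'⟩ := hN
  refine ⟨isoMk (e ≪≫ e'.symm) (Over.OverMorphism.ext ?_)⟩
  change (e.hom.left ≫ e'.inv.left) ≫ N.π.left = M.π.left
  have h : e'.inv.left ≫ e'.hom.left = 𝟙 _ := congrArg (fun g ↦ g.left) e'.inv_hom_id
  rw [← he, ← he', Category.assoc, reassoc_of% h]

instance : EssentiallySmall.{u} (BirationalModel X) := by
  rw [essentiallySmall_iff]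
  refine ⟨?_, inferInstance⟩
  -- A model is determined up to isomorphism by an ideal sheaf on some projective space and a
  -- morphism to `X`, and such data form a type in `u`.
  let t (M : Skeleton (BirationalModel X)) : Data X :=
    (exists_describes ((fromSkeleton _).obj M)).choose
  refine small_of_injective (f := t) fun M N h ↦ ?_
  have h1 : Describes (t M) ((fromSkeleton _).obj M) := (exists_describes _).choose_spec
  have h2 : Describes (t N) ((fromSkeleton _).obj N) := (exists_describes _).choose_spec
  rw [← h] at h2
  obtain ⟨e⟩ := nonempty_iso_of_describes h1 h2
  exact skeleton_skeletal _ ⟨(fromSkeleton _).preimageIso e⟩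

end BirationalModel

end ZariskiRiemann

/-! ### Images of stalk maps -/

namespace AlgebraicGeometry.LocallyRingedSpace

/-- The range of the map induced on the stalk at a point by a morphism of locally ringed spaces. -/
def stalkRange {T Y : LocallyRingedSpace.{u}} (f : T ⟶ Y) (t : T) : Set (T.presheaf.stalk t) :=
  Set.range (f.stalkMap t)

lemma stalkMap_mem_stalkRange_comp {T Y Z : LocallyRingedSpace.{u}} (f : T ⟶ Y) (g : Y ⟶ Z) (t : T)
    {σ : Y.presheaf.stalk (f.base t)} (h : σ ∈ stalkRange g (f.base t)) :
    f.stalkMap t σ ∈ stalkRange (f ≫ g) t := by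
  obtain ⟨τ, rfl⟩ := h
  exact ⟨τ, ConcreteCategory.congr_hom (stalkMap_comp f g t) τ⟩

lemma stalkRange_comp_subset {T Y Z : LocallyRingedSpace.{u}} (f : T ⟶ Y) (g : Y ⟶ Z) (t : T) :
    stalkRange (f ≫ g) t ⊆ stalkRange f t := by
  rintro _ ⟨τ, rfl⟩
  exact ⟨g.stalkMap _ τ, (ConcreteCategory.congr_hom (stalkMap_comp f g t) τ).symm⟩

lemma pullbackGerm_injective {T Y : PresheafedSpace CommRingCat.{u}} (g : T ⟶ Y) (t : T)
    (U : TopologicalSpace.Opens Y) (h : g.base t ∈ U) (h1 : Function.Injective (g.stalkMap t))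
    (h2 : Function.Injective (Y.presheaf.germ U (g.base t) h)) :
    Function.Injective (pullbackGerm g t U h) := fun a b e ↦ by
  rw [pullbackGerm_eq, pullbackGerm_eq] at e
  exact h2 (h1 e)

lemma stalkRange_subset_comp {T Y Z : LocallyRingedSpace.{u}} (f : T ⟶ Y) (g : Y ⟶ Z) (t : T)
    (h : Function.Surjective (g.stalkMap (f.base t))) : stalkRange f t ⊆ stalkRange (f ≫ g) t := by
  rintro _ ⟨σ, rfl⟩
  exact stalkMap_mem_stalkRange_comp f g t (h σ)

end AlgebraicGeometry.LocallyRingedSpace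

/-! ### The system of models is generic; points and stalks of its limit -/

namespace ZariskiRiemann

open LocallyRingedSpace LocallyRingedSpace.GenericLimit

section

variable {K : Type u} [Field K] {X Y Z : Scheme.{u}}

lemma isField_stalk [IsIntegral X] (η : Spec (.of K) ⟶ X) [IsDominant η] :
    IsField (X.presheaf.stalk (imagePoint η)) :=
  isField_stalk_of_closure_mem_irreducibleComponents X _ (by
    rw [closure_imagePoint, irreducibleComponents_eq_singleton]
    rfl)

lemma pullbackGerm_injective [IsIntegral X] (η : Spec (.of K) ⟶ X) [IsDominant η] (U : X.Opens)
    (h : imagePoint η ∈ U) : Function.Injective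
      (pullbackGerm η.toLRSHom.toHom (IsLocalRing.closedPoint K) U h) := by
  let := (isField_stalk η).toField
  let t : Spec (.of K) := IsLocalRing.closedPoint K
  have h1 : Function.Injective (η.stalkMap t) := (η.stalkMap t).hom.injective
  have h2 := germ_injective_of_isIntegral X (imagePoint η) h
  exact LocallyRingedSpace.pullbackGerm_injective η.toLRSHom.toHom t U h h1 h2

/-- The dominant point factors through the open set on which `f` is an open immersion, so passing
from `Z` to `Y` loses no elements of the stalk at the point. -/
lemma IsBirational.stalkRange_subset_comp {f : Z ⟶ Y} (hf : IsBirational f)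
    (η : Spec (.of K) ⟶ Z) [IsDominant η] [Nonempty Z] :
    stalkRange η.toLRSHom (IsLocalRing.closedPoint K) ⊆
      stalkRange (η ≫ f).toLRSHom (IsLocalRing.closedPoint K) := by
  obtain ⟨p, hp⟩ := hf
  obtain ⟨x, hx⟩ := p.dense_source.nonempty
  obtain ⟨η', h, -⟩ := exists_lift_opens η p.source hx
  have : SurjectiveOnStalks (p.source.ι ≫ f) := by
    rw [← hp]
    infer_instance
  rw [← h, Category.assoc]
  exact (stalkRange_comp_subset η'.toLRSHom p.source.ι.toLRSHom _).trans
    (LocallyRingedSpace.stalkRange_subset_comp η'.toLRSHom (p.source.ι ≫ f).toLRSHom _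
      ((p.source.ι ≫ f).stalkMap_surjective _))

end

namespace BirationalModel

variable {k K : Type u} [Field k] [Field K] {X : Over (Spec (.of k))} [IsIntegral X.left]
  {η : Spec (.of K) ⟶ X.left} (hη : IsGenericPoint η)

/-- The lift of a generic point of `X` to a model. -/
def lift (M : BirationalModel X) : Spec (.of K) ⟶ M.Y.left := (M.exists_isGenericPoint hη).choose

lemma isGenericPoint_lift (M : BirationalModel X) : IsGenericPoint (lift hη M) :=
  (M.exists_isGenericPoint hη).choose_spec.1

lemma lift_π (M : BirationalModel X) : lift hη M ≫ M.π.left = η :=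
  (M.exists_isGenericPoint hη).choose_spec.2

instance (M : BirationalModel X) : IsDominant (lift hη M) := (isGenericPoint_lift hη M).isDominant

lemma lift_trivial (hX : IsProjectiveVariety X) : lift hη (trivial X hX) = η :=
  (Category.comp_id _).symm.trans (lift_π hη (trivial X hX))

/-- The cone over the system of models given by the lifts of a generic point. -/
def genericCone : Cone (system X) where
  pt := (Spec (.of K)).toLocallyRingedSpace
  π :=
    { app M := (lift hη M).toLRSHom
      naturality M N f := by
        refine (Category.id_comp _).trans (congrArg Scheme.Hom.toLRSHom
          (comp_hom_left (isGenericPoint_lift hη M) (isGenericPoint_lift hη N) ?_ f)).symm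
        rw [lift_π, lift_π] }

lemma isGeneric_whisker {J : Type u} [SmallCategory J] (G : J ⥤ BirationalModel X) :
    IsGeneric ((genericCone hη).whisker G) (IsLocalRing.closedPoint K) where
  mem j U _ hy := imagePoint_mem (lift hη (G.obj j)) U hy
  inj j U h := pullbackGerm_injective (lift hη (G.obj j)) U h

variable (hX : IsProjectiveVariety X)

omit [IsIntegral X.left] in
include hX in
lemma hasLimit_system : HasLimit (system X) := by
  have := hX.isIntegral
  obtain ⟨K, _, η, hη⟩ := ZariskiRiemann.exists_isGenericPoint X.left
  have := isCofiltered hX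
  have : IsCofiltered (SmallModel.{u} (BirationalModel X)) :=
    .of_equivalence (equivSmallModel (BirationalModel X))
  let e := (equivSmallModel.{u} (BirationalModel X)).symm
  have : HasLimit (e.functor ⋙ system X) :=
    ⟨⟨_, isLimitLimitCone (isGeneric_whisker hη e.functor)⟩⟩
  exact hasLimit_of_equivalence_comp e

include hX in
lemma exists_iso_limitSpace {c : Cone (system X)} (hc : IsLimit c) :
    ∃ (J : Type u) (_ : SmallCategory J) (_ : IsCofiltered J) (G : J ⥤ BirationalModel X)
      (K : Type u) (_ : Field K) (η : Spec (.of K) ⟶ X.left) (hη : IsGenericPoint η)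
      (φ : c.pt ≅ limitSpace (isGeneric_whisker hη G)),
      ∀ j, φ.hom ≫ limitProj (isGeneric_whisker hη G) j = c.π.app (G.obj j) := by
  obtain ⟨K, _, η, hη⟩ := ZariskiRiemann.exists_isGenericPoint X.left
  have := isCofiltered hX
  have : IsCofiltered (SmallModel.{u} (BirationalModel X)) :=
    .of_equivalence (equivSmallModel (BirationalModel X))
  let e := (equivSmallModel.{u} (BirationalModel X)).symm
  have hc' : IsLimit (c.whisker e.functor) := hc.whiskerEquivalence e
  exact ⟨_, inferInstance, inferInstance, e.functor, K, inferInstance, η, hη,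
    hc'.conePointUniqueUpToIso (isLimitLimitCone (isGeneric_whisker hη e.functor)),
    fun j ↦ hc'.conePointUniqueUpToIso_hom_comp _ j⟩

include hX in
lemma specializes_of_isLimit {c : Cone (system X)} (hc : IsLimit c) {w z : c.pt}
    (h : ∀ M, (c.π.app M).base w ⤳ (c.π.app M).base z) : w ⤳ z := by
  obtain ⟨J, _, _, G, K, _, η, hη, φ, hφ⟩ := exists_iso_limitSpace hX hc
  have h1 : φ.hom.base w ⤳ φ.hom.base z := by
    refine GenericLimit.specializes_of_forall_coord fun j ↦ ?_
    change (φ.hom ≫ limitProj (isGeneric_whisker hη G) j).base w ⤳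
      (φ.hom ≫ limitProj (isGeneric_whisker hη G) j).base z
    rw [hφ]
    exact h _
  have h2 := h1.map φ.inv.base.hom.continuous
  have e (x : c.pt) : φ.inv.base (φ.hom.base x) = x := by
    change (φ.hom ≫ φ.inv).base x = x
    rw [φ.hom_inv_id]
    rfl
  change φ.inv.base (φ.hom.base w) ⤳ φ.inv.base (φ.hom.base z) at h2
  rwa [e, e] at h2

include hX in
lemma exists_mem_stalkRange {c : Cone (system X)} (hc : IsLimit c) (z : c.pt)
    (σ : c.pt.presheaf.stalk z) : ∃ M, σ ∈ stalkRange (c.π.app M) z := by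
  obtain ⟨J, _, _, G, K, _, η, hη, φ, hφ⟩ := exists_iso_limitSpace hX hc
  obtain ⟨σ', rfl⟩ : ∃ σ', φ.hom.stalkMap z σ' = σ :=
    (ConcreteCategory.bijective_of_isIso (φ.hom.stalkMap z)).2 σ
  obtain ⟨j, τ, hτ⟩ := GenericLimit.exists_stalkMap_eq (isGeneric_whisker hη G) (φ.hom.base z) σ'
  refine ⟨G.obj j, ?_⟩
  rw [← hφ j]
  exact stalkMap_mem_stalkRange_comp _ _ _ ⟨τ, hτ⟩

end BirationalModel

end ZariskiRiemann

/-! ### The two implications -/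

namespace ZariskiRiemann

open LocallyRingedSpace BirationalModel

variable {k : Type u} [Field k] {X Y Z : Over (Spec (.of k))}

/-- The projection from the Zariski–Riemann space to a model. -/
def modelProj [HasLimit (system X)] (M : BirationalModel X) :
    limit (system X) ⟶ M.Y.left.toLocallyRingedSpace :=
  limit.π (system X) M

/-- The projection from the Zariski–Riemann space of `X` to `X`. -/
def baseProj (hX : IsProjectiveVariety X) [HasLimit (system X)] :
    limit (system X) ⟶ X.left.toLocallyRingedSpace :=
  limit.π (system X) (trivial X hX)

lemma modelProj_π (hX : IsProjectiveVariety X) [HasLimit (system X)] (M : BirationalModel X) :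
    modelProj M ≫ M.π.left.toLRSHom = baseProj hX :=
  limit.w (system X) (⟨M.π, Category.comp_id _, M.isBirational⟩ : M ⟶ trivial X hX)

lemma nonempty_space_iso_of_isBirational (hZ : IsProjectiveVariety Z) (hX : IsProjectiveVariety X)
    [HasLimit (system Z)] [HasLimit (system X)] (p : Z ⟶ X) (hp : IsBirational p.left) :
    Nonempty (space Z hZ ≅ space X hX) := by
  have := initial_pushforward hX hZ p hp
  -- Pushing forward does not change the underlying varieties, so the composite is definitionally
  -- `system Z`.
  have : HasLimit (pushforward p hp ⋙ system X) := inferInstanceAs (HasLimit (system Z))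
  let M : BirationalModel X := (pushforward p hp).obj (trivial Z hZ)
  let e : limit (system Z) ≅ limit (system X) :=
    Functor.Initial.limitIso (pushforward p hp) (system X)
  let π : limit (system X) ⟶ Z.left.toLocallyRingedSpace := modelProj M
  have h1 : e.inv ≫ baseProj hZ = π :=
    limit.pre_π (system X) (pushforward p hp) (trivial Z hZ)
  have h2 : π ≫ p.left.toLRSHom = baseProj hX :=
    (congrArg (π ≫ ·) (congrArg Scheme.Hom.toLRSHom (Category.id_comp p.left))).symm.trans
      (modelProj_π hX M)
  have h3 : Z.hom.toLRSHom = p.left.toLRSHom ≫ X.hom.toLRSHom :=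
    congrArg Scheme.Hom.toLRSHom (Over.w p).symm
  refine ⟨(Over.isoMk e.symm ?_).symm⟩
  change e.inv ≫ baseProj hZ ≫ Z.hom.toLRSHom = baseProj hX ≫ X.hom.toLRSHom
  rw [reassoc_of% h1, h3, reassoc_of% h2]

theorem nonempty_space_iso_of_birationalOver (hX : IsProjectiveVariety X)
    (hY : IsProjectiveVariety Y) [HasLimit (system X)] [HasLimit (system Y)]
    (h : Scheme.BirationalOver X.hom Y.hom) : Nonempty (space X hX ≅ space Y hY) := by
  have := hX.isIntegral
  obtain ⟨K, _, x, hx⟩ := ZariskiRiemann.exists_isGenericPoint X.left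
  obtain ⟨y, hy, e⟩ := exists_isGenericPoint_of_birationalOver h hx
  obtain ⟨Z, hZ, -, -, p, q, -, -, hp, hq⟩ := exists_join_isBirational hX hY hx hy e.symm
  have := hasLimit_system hZ
  obtain ⟨e1⟩ := nonempty_space_iso_of_isBirational hZ hX p hp
  obtain ⟨e2⟩ := nonempty_space_iso_of_isBirational hZ hY q hq
  exact ⟨e1.symm ≪≫ e2⟩

theorem birationalOver_of_space_iso (hX : IsProjectiveVariety X)
    (hY : IsProjectiveVariety Y) [HasLimit (system X)] [HasLimit (system Y)]
    (φ : space X hX ≅ space Y hY) : Scheme.BirationalOver X.hom Y.hom := by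
  have := hX.isIntegral
  have := hY.isIntegral
  have := hX.isSeparated
  have := hY.isSeparated
  have := hX.locallyOfFiniteType
  have := hY.locallyOfFiniteType
  obtain ⟨K, _, x, hx⟩ := ZariskiRiemann.exists_isGenericPoint X.left
  obtain ⟨L, _, y, hy⟩ := ZariskiRiemann.exists_isGenericPoint Y.left
  let ξ : (Spec (.of K)).toLocallyRingedSpace ⟶ limit (system X) :=
    limit.lift (system X) (genericCone hx)
  let ζ : (Spec (.of L)).toLocallyRingedSpace ⟶ limit (system Y) :=
    limit.lift (system Y) (genericCone hy)
  have hξ M : ξ ≫ modelProj M = (lift hx M).toLRSHom := limit.lift_π (genericCone hx) M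
  have hξ₀ : ξ ≫ baseProj hX = x.toLRSHom :=
    (hξ (trivial X hX)).trans (congrArg _ (lift_trivial hx hX))
  have hζ M : ζ ≫ modelProj M = (lift hy M).toLRSHom := limit.lift_π (genericCone hy) M
  let f : limit (system X) ⟶ limit (system Y) := φ.hom.left
  let g : limit (system Y) ⟶ limit (system X) := φ.inv.left
  have hfg : f ≫ g = 𝟙 _ := congrArg (fun h ↦ h.left) φ.hom_inv_id
  have hgf : g ≫ f = 𝟙 _ := congrArg (fun h ↦ h.left) φ.inv_hom_id
  have hf : f ≫ baseProj hY ≫ Y.hom.toLRSHom =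
      baseProj hX ≫ X.hom.toLRSHom := Over.w φ.hom
  let θ (M : BirationalModel Y) : Spec (.of K) ⟶ M.Y.left := ⟨ξ ≫ f ≫ modelProj M⟩
  have hθdom (M : BirationalModel Y) : IsDominant (θ M) := by
    refine isDominant_of_mem _ fun U u hu ↦ ?_
    -- In every model of `X` the image of `ξ` is generic, so `ξ` specializes to every point of the
    -- limit, in particular to the transported generic point of the other space.
    have h1 : ξ.base (IsLocalRing.closedPoint K) ⤳
        g.base (ζ.base (IsLocalRing.closedPoint L)) := by
      refine specializes_of_isLimit hX (limit.isLimit (system X)) fun N ↦ ?_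
      change (ξ ≫ modelProj N).base (IsLocalRing.closedPoint K) ⤳ _
      rw [hξ]
      refine specializes_iff_mem_closure.mpr ?_
      exact (closure_imagePoint (lift hx N)).ge (Set.mem_univ _)
    have h2 := h1.map (f ≫ modelProj M).base.hom.continuous
    have h3 : ((g ≫ f) ≫ modelProj M).base (ζ.base (IsLocalRing.closedPoint L)) ∈ U := by
      rw [hgf, Category.id_comp]
      change (ζ ≫ modelProj M).base (IsLocalRing.closedPoint L) ∈ U
      rw [hζ]
      exact imagePoint_mem (lift hy M) U hu
    exact h2.mem_open U.2 h3
  let θ₀ : Spec (.of K) ⟶ Y.left := ⟨ξ ≫ f ≫ baseProj hY⟩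
  have hθπ (M : BirationalModel Y) : θ M ≫ M.π.left = θ₀ := by
    refine Scheme.Hom.ext' ?_
    change (ξ ≫ f ≫ modelProj M) ≫ M.π.left.toLRSHom = ξ ≫ f ≫ baseProj hY
    rw [Category.assoc, Category.assoc, modelProj_π hY]
  have hsurj : SurjectiveOnStalks (θ₀) := by
    refine ⟨fun q ↦ ?_⟩
    obtain rfl : IsLocalRing.closedPoint K = q := Subsingleton.elim (α := PrimeSpectrum K) _ _
    intro b
    have := hx.isPreimmersion
    -- Since `f ≫ g` is the identity, `x` factors through `ξ ≫ f`. As `x` is surjective on stalks,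
    -- so is `ξ ≫ f`.
    have h1 : b ∈ stalkRange (ξ ≫ f) (IsLocalRing.closedPoint K) := by
      have : b ∈ stalkRange x.toLRSHom (IsLocalRing.closedPoint K) := x.stalkMap_surjective _ b
      refine stalkRange_comp_subset (ξ ≫ f) (g ≫ baseProj hX) _ ?_
      rw [Category.assoc, reassoc_of% hfg, hξ₀]
      exact this
    obtain ⟨σ, rfl⟩ := h1
    -- The element already comes from a single model `M`, and birationality of `M.π` moves it down
    -- to the stalk of `Y`.
    obtain ⟨M, hM⟩ := exists_mem_stalkRange hY (limit.isLimit (system Y)) _ σ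
    have h2 := stalkMap_mem_stalkRange_comp (ξ ≫ f) (modelProj M) _ hM
    rw [Category.assoc] at h2
    have h3 := M.isBirational.stalkRange_subset_comp (θ M) h2
    rw [hθπ] at h3
    exact h3
  have hθ : IsGenericPoint (θ₀) :=
    ⟨hθdom (trivial Y hY), isPreimmersion_of_surjectiveOnStalks _⟩
  refine birationalOver_of_isGenericPoint X.hom Y.hom hx hθ (Scheme.Hom.ext' ?_)
  change x.toLRSHom ≫ X.hom.toLRSHom =
    (ξ ≫ f ≫ baseProj hY) ≫ Y.hom.toLRSHom
  rw [Category.assoc, Category.assoc, hf, reassoc_of% hξ₀]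

end ZariskiRiemann

end

/-- The Zariski–Riemann spaces of two projective varieties over an algebraically closed field `k`
of characteristic zero exist (the projective limits are locally ringed spaces), and they are
isomorphic as locally ringed spaces over `k` if and only if the varieties are birational
over `k`. -/
theorem mainTheorem3 {k : Type u} [Field k] [IsAlgClosed k] [CharZero k]
    (X Y : Over (Spec (.of k)))
    (hX : ZariskiRiemann.IsProjectiveVariety X) (hY : ZariskiRiemann.IsProjectiveVariety Y) :
    ∃ (_ : HasLimit (ZariskiRiemann.BirationalModel.system X))
      (_ : HasLimit (ZariskiRiemann.BirationalModel.system Y)),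
      Nonempty (ZariskiRiemann.space X hX ≅ ZariskiRiemann.space Y hY) ↔
        Scheme.BirationalOver X.hom Y.hom :=
  have h1 := ZariskiRiemann.BirationalModel.hasLimit_system hX
  have h2 := ZariskiRiemann.BirationalModel.hasLimit_system hY
  ⟨h1, h2, fun ⟨φ⟩ ↦ ZariskiRiemann.birationalOver_of_space_iso hX hY φ,
    ZariskiRiemann.nonempty_space_iso_of_birationalOver hX hY⟩
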